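/- Let $\mathrm{HA}_{\longrightarrow}$ be the following theory in intuitionistic deduction modulo. There are two sorts, $\iota$ (numbers) and $\kappa$ (classes). The symbols are a constant $0$ of sort $\iota$; function symbols $S,\mathit{Pred}$ of rank $\langle\iota,\iota\rangle$ and $+,\times$ of rank $\langle\iota,\iota,\iota\rangle$; predicate symbols $=$ of rank $\langle\iota,\iota\rangle$, $\mathit{Null}$ and $N$ of rank $\langle\iota\rangle$, $\in$ of rank $\langle\iota,\kappa\rangle$; and, for each $n\ge 0$ and each proposition $P$ in the one-sorted language (sort $\iota$) $0,S,\mathit{Pred},+,\times,=,\mathit{Null},N$ whose free variables are among $x,y_1,\dots,y_n$, a function symbol $f_{x,y_1,\dots,y_n,P}$ of rank $\langle\iota,\dots,\iota,\kappa\rangle$ with $n$ arguments. Propositions are built from atomic ones with $\top,\bot,\Rightarrow,\wedge,\vee$ and the quantifiers $\forall,\exists$ over either sort. The theory has no axioms, and $\equiv$ is the congruence on propositions generated by the rewrite rules $$y=z\longrightarrow\forall p\,(y\in p\Rightarrow z\in p),$$ $$N(n)\longrightarrow\forall p\,\bigl(0\in p\Rightarrow\forall y\,(N(y)\Rightarrow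 y\in p\Rightarrow S(y)\in p)\Rightarrow n\in p\bigr),$$ $$x\in f_{x,y_1,\dots,y_n,P}(y_1,\dots,y_n)\longrightarrow P,$$ $$\mathit{Pred}(0)\longrightarrow 0,\quad \mathit{Pred}(S(x))\longrightarrow x,\quad \mathit{Null}(0)\longrightarrow\top,\quad \mathit{Null}(S(x))\longrightarrow\bot,$$ $$0+y\longrightarrow y,\quad S(x)+y\longrightarrow S(x+y),\quad 0\times y\longrightarrow 0,\quad S(x)\times y\longrightarrow x\times y+y .$$ Proofs are derivations in natural deduction modulo $\equiv$, that is, intuitionistic natural deduction whose rules may replace propositions by $\equiv$-equivalent ones (for instance, $B$ follows from $C$ and $A$ if $C\equiv(A\Rightarrow B)$). They are written as proof-terms $$\pi ::= \alpha\mid\lambda\alpha\,\pi\mid(\pi\,\pi')\mid\langle\pi,\pi'\rangle\mid\mathit{fst}(\pi)\mid\mathit{snd}(\pi)\mid i(\pi)\mid j(\pi)\mid\delta(\pi_1,\alpha\pi_2,\beta\pi_3)\mid I\mid\delta_\bot(\pi)\mid\lambda x\,\pi\mid(\pi\,t)\mid\langle t,\pi\rangle\mid\delta_\exists(\pi,x\alpha\,\pi'),$$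 one construction for each deduction rule, where $t$ ranges over the terms of the language and $x$ over the variables of both sorts. Reduction $\triangleright$ is the contextual closure of the cut elimination rules $$(\lambda\alpha\,\pi_1\;\pi_2)\triangleright(\pi_2/\alpha)\pi_1,\quad(\lambda x\,\pi\;t)\triangleright(t/x)\pi,\quad \mathit{fst}\langle\pi_1,\pi_2\rangle\triangleright\pi_1,\quad \mathit{snd}\langle\pi_1,\pi_2\rangle\triangleright\pi_2,$$ $$\delta(i(\pi_1),\alpha\pi_2,\beta\pi_3)\triangleright(\pi_1/\alpha)\pi_2,\quad \delta(j(\pi_1),\alpha\pi_2,\beta\pi_3)\triangleright(\pi_1/\beta)\pi_3,\quad \delta_\exists(\langle t,\pi_1\rangle,x\alpha\,\pi_2)\triangleright(t/x,\pi_1/\alpha)\pi_2 .$$ A proof-term is cut-free if no reduction step starts from it. Proposition. The theory $\mathrm{HA}_{\longrightarrow}$ has the cut elimination property: for all finite contexts $\Gamma$ and propositions $A$, every proof $\pi$ of $\Gamma\vdash_{\equiv}A$ in $\mathrm{HA}_{\longrightarrow}$ is strongly normalizable (every reduction sequence starting from $\pi$ is finite), and $\pi$ reduces in finitely many steps to a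 cut-free proof of the same sequent $\Gamma\vdash_{\equiv}A$. -/

import Mathlib

/-!  Intuitionistic natural deduction modulo the rewrite rules of the theory `HA→`, with
proof-terms. Expressions are taken up to renaming of bound variables: variables are de Bruijn
indices, with one independent index space for each of the two sorts of term variables and
one for proof variables. Free variables are the indices that exceed the number of enclosing
binders of that kind. -/

namespace HAModulo

/-! ### The language -/

/-- The two sorts: `iota` for numbers, `kappa` for classes of numbers. -/
inductive Srt : Type
  | iota
  | kappa

/-- Terms of sort `ι` over the variables `V`. -/
inductive ITerm (V : Type) : Type
  | var (v : V) : ITerm V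
  | zero : ITerm V
  | succ (t : ITerm V) : ITerm V
  | pred (t : ITerm V) : ITerm V
  | add (t u : ITerm V) : ITerm V
  | mul (t u : ITerm V) : ITerm V

/-- Simultaneous substitution in terms of sort `ι`. -/
def ITerm.bind {V W : Type} : ITerm V → (V → ITerm W) → ITerm W
  | .var v, σ => σ v
  | .zero, _ => .zero
  | .succ t, σ => .succ (t.bind σ)
  | .pred t, σ => .pred (t.bind σ)
  | .add t u, σ => .add (t.bind σ) (u.bind σ)
  | .mul t u, σ => .mul (t.bind σ) (u.bind σ)

/-- Propositions in the language `0, S, Pred, +, ×, =, Null, N` (with the only sort `ι`) whose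
free variables are among the `n` variables `0, …, n - 1`. -/
inductive NFormula : ℕ → Type
  | eq {n : ℕ} (t u : ITerm (Fin n)) : NFormula n
  | null {n : ℕ} (t : ITerm (Fin n)) : NFormula n
  | nat {n : ℕ} (t : ITerm (Fin n)) : NFormula n
  | top {n : ℕ} : NFormula n
  | bot {n : ℕ} : NFormula n
  | imp {n : ℕ} (A B : NFormula n) : NFormula n
  | and {n : ℕ} (A B : NFormula n) : NFormula n
  | or {n : ℕ} (A B : NFormula n) : NFormula n
  | all {n : ℕ} (A : NFormula (n + 1)) : NFormula n
  | ex {n : ℕ} (A : NFormula (n + 1)) : NFormula n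

/-- Terms of sort `κ`: variables, and `f_{x,y₁,…,yₙ,P}(t₁,…,tₙ)`. In `P` the variable `0` stands
for `x` and the variable `i + 1` for the parameter to which the argument `ts i` is passed. -/
inductive KTerm : Type
  | var (v : ℕ) : KTerm
  | cls {n : ℕ} (P : NFormula (n + 1)) (ts : Fin n → ITerm ℕ) : KTerm

/-- Simultaneous well-sorted substitutions of terms for term variables: `num v` is substituted for
the variable `v` of sort `ι`, and `cls v` for the variable `v` of sort `κ`. -/
structure TSub : Type where
  num : ℕ → ITerm ℕ
  cls : ℕ → KTerm

/-- Simultaneous substitution in terms of sort `κ`. -/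
def KTerm.bind : KTerm → TSub → KTerm
  | .var v, σ => σ.cls v
  | .cls P ts, σ => .cls P (fun i => (ts i).bind σ.num)

/-- Terms of a given sort. -/
inductive Tm : Srt → Type
  | num (t : ITerm ℕ) : Tm .iota
  | cls (p : KTerm) : Tm .kappa

/-- Simultaneous substitution in terms of a given sort. -/
def Tm.subst : {s : Srt} → Tm s → TSub → Tm s
  | _, .num t, σ => .num (t.bind σ.num)
  | _, .cls p, σ => .cls (p.bind σ)

/-- The identity substitution. -/
def TSub.id : TSub := ⟨.var, .var⟩

/-- The renaming that increments every variable of sort `s`. -/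
def TSub.shift : Srt → TSub
  | .iota => ⟨fun v => .var (v + 1), .var⟩
  | .kappa => ⟨.var, fun v => .var (v + 1)⟩

/-- The substitution that maps variable `0` of the sort of `t` to `t`, and each variable `v + 1`
of this sort to the image of `v` under `σ`; it agrees with `σ` on the other sort. -/
def TSub.cons : {s : Srt} → Tm s → TSub → TSub
  | _, .num t, σ => ⟨fun | 0 => t | v + 1 => σ.num v, σ.cls⟩
  | _, .cls p, σ => ⟨σ.num, fun | 0 => p | v + 1 => σ.cls v⟩

/-- The variable `v` of sort `s`. -/
def Tm.var : (s : Srt) → ℕ → Tm s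
  | .iota, v => .num (.var v)
  | .kappa, v => .cls (.var v)

/-- The substitution `σ` pushed under a binder of sort `s`. -/
def TSub.up (s : Srt) (σ : TSub) : TSub :=
  TSub.cons (Tm.var s 0)
    ⟨fun v => (σ.num v).bind (TSub.shift s).num, fun v => (σ.cls v).bind (TSub.shift s)⟩

/-- The substitution `(t/x)`, where `x` is the variable `0` of the sort of `t`, whose binder is
removed. -/
def TSub.single {s : Srt} (t : Tm s) : TSub := TSub.cons t TSub.id

/-- Propositions of `HA→`. -/
inductive Formula : Type
  | eq (t u : ITerm ℕ) : Formula
  | null (t : ITerm ℕ) : Formula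
  | nat (t : ITerm ℕ) : Formula
  | mem (t : ITerm ℕ) (p : KTerm) : Formula
  | top : Formula
  | bot : Formula
  | imp (A B : Formula) : Formula
  | and (A B : Formula) : Formula
  | or (A B : Formula) : Formula
  | all (s : Srt) (A : Formula) : Formula
  | ex (s : Srt) (A : Formula) : Formula

/-- Capture-avoiding substitution in propositions. -/
def Formula.subst : Formula → TSub → Formula
  | .eq t u, σ => .eq (t.bind σ.num) (u.bind σ.num)
  | .null t, σ => .null (t.bind σ.num)
  | .nat t, σ => .nat (t.bind σ.num)
  | .mem t p, σ => .mem (t.bind σ.num) (p.bind σ)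
  | .top, _ => .top
  | .bot, _ => .bot
  | .imp A B, σ => .imp (A.subst σ) (B.subst σ)
  | .and A B, σ => .and (A.subst σ) (B.subst σ)
  | .or A B, σ => .or (A.subst σ) (B.subst σ)
  | .all s A, σ => .all s (A.subst (TSub.up s σ))
  | .ex s A, σ => .ex s (A.subst (TSub.up s σ))

/-- Weakening of a proposition by a fresh variable of sort `s`. -/
def Formula.shift (s : Srt) (A : Formula) : Formula := A.subst (TSub.shift s)

/-- The proposition of `HA→` obtained from a proposition in the language
`0, S, Pred, +, ×, =, Null, N` by substituting the terms `σ` for its free variables. -/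
def NFormula.inst : {n : ℕ} → NFormula n → (Fin n → ITerm ℕ) → Formula
  | _, .eq t u, σ => .eq (t.bind σ) (u.bind σ)
  | _, .null t, σ => .null (t.bind σ)
  | _, .nat t, σ => .nat (t.bind σ)
  | _, .top, _ => .top
  | _, .bot, _ => .bot
  | _, .imp A B, σ => .imp (A.inst σ) (B.inst σ)
  | _, .and A B, σ => .and (A.inst σ) (B.inst σ)
  | _, .or A B, σ => .or (A.inst σ) (B.inst σ)
  | _, .all A, σ =>
      .all .iota (A.inst (Fin.cons (.var 0) (fun i => (σ i).bind (fun v => .var (v + 1)))))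
  | _, .ex A, σ =>
      .ex .iota (A.inst (Fin.cons (.var 0) (fun i => (σ i).bind (fun v => .var (v + 1)))))

/-! ### The rewrite rules and the congruence -/

/-- One-step rewriting of terms of sort `ι`. -/
inductive ITerm.Step : ITerm ℕ → ITerm ℕ → Prop
  | pred_zero : Step (.pred .zero) .zero
  | pred_succ (x : ITerm ℕ) : Step (.pred (.succ x)) x
  | zero_add (y : ITerm ℕ) : Step (.add .zero y) y
  | succ_add (x y : ITerm ℕ) : Step (.add (.succ x) y) (.succ (.add x y))
  | zero_mul (y : ITerm ℕ) : Step (.mul .zero y) .zero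
  | succ_mul (x y : ITerm ℕ) : Step (.mul (.succ x) y) (.add (.mul x y) y)
  | succ {t t' : ITerm ℕ} : Step t t' → Step (.succ t) (.succ t')
  | pred {t t' : ITerm ℕ} : Step t t' → Step (.pred t) (.pred t')
  | add_left {t t' u : ITerm ℕ} : Step t t' → Step (.add t u) (.add t' u)
  | add_right {t u u' : ITerm ℕ} : Step u u' → Step (.add t u) (.add t u')
  | mul_left {t t' u : ITerm ℕ} : Step t t' → Step (.mul t u) (.mul t' u)
  | mul_right {t u u' : ITerm ℕ} : Step u u' → Step (.mul t u) (.mul t u')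

/-- One-step rewriting of terms of sort `κ`. -/
inductive KTerm.Step : KTerm → KTerm → Prop
  | arg {n : ℕ} (P : NFormula (n + 1)) (ts : Fin n → ITerm ℕ) (i : Fin n) {t' : ITerm ℕ} :
      ITerm.Step (ts i) t' → Step (.cls P ts) (.cls P (Function.update ts i t'))

/-- `∀ p (y ∈ p ⇒ z ∈ p)` -/
def eqBody (y z : ITerm ℕ) : Formula :=
  .all .kappa (.imp (.mem y (.var 0)) (.mem z (.var 0)))

/-- `∀ p (0 ∈ p ⇒ ∀ y (N(y) ⇒ y ∈ p ⇒ S(y) ∈ p) ⇒ n ∈ p)` -/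
def natBody (n : ITerm ℕ) : Formula :=
  .all .kappa
    (.imp (.mem .zero (.var 0))
      (.imp
        (.all .iota
          (.imp (.nat (.var 0))
            (.imp (.mem (.var 0) (.var 0)) (.mem (.succ (.var 0)) (.var 0)))))
        (.mem n (.var 0))))

/-- One-step rewriting of propositions. -/
inductive Formula.Step : Formula → Formula → Prop
  | eq_rule (y z : ITerm ℕ) : Step (.eq y z) (eqBody y z)
  | nat_rule (n : ITerm ℕ) : Step (.nat n) (natBody n)
  | mem_cls {n : ℕ} (x : ITerm ℕ) (P : NFormula (n + 1)) (ts : Fin n → ITerm ℕ) :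
      Step (.mem x (.cls P ts)) (P.inst (Fin.cons x ts))
  | null_zero : Step (.null .zero) .top
  | null_succ (x : ITerm ℕ) : Step (.null (.succ x)) .bot
  | eq_left {t t' u : ITerm ℕ} : ITerm.Step t t' → Step (.eq t u) (.eq t' u)
  | eq_right {t u u' : ITerm ℕ} : ITerm.Step u u' → Step (.eq t u) (.eq t u')
  | null {t t' : ITerm ℕ} : ITerm.Step t t' → Step (.null t) (.null t')
  | nat {t t' : ITerm ℕ} : ITerm.Step t t' → Step (.nat t) (.nat t')
  | mem_left {t t' : ITerm ℕ} {p : KTerm} : ITerm.Step t t' → Step (.mem t p) (.mem t' p)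
  | mem_right {t : ITerm ℕ} {p p' : KTerm} : KTerm.Step p p' → Step (.mem t p) (.mem t p')
  | imp_left {A A' B : Formula} : Step A A' → Step (.imp A B) (.imp A' B)
  | imp_right {A B B' : Formula} : Step B B' → Step (.imp A B) (.imp A B')
  | and_left {A A' B : Formula} : Step A A' → Step (.and A B) (.and A' B)
  | and_right {A B B' : Formula} : Step B B' → Step (.and A B) (.and A B')
  | or_left {A A' B : Formula} : Step A A' → Step (.or A B) (.or A' B)
  | or_right {A B B' : Formula} : Step B B' → Step (.or A B) (.or A B')
  | all {s : Srt} {A A' : Formula} : Step A A' → Step (.all s A) (.all s A')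
  | ex {s : Srt} {A A' : Formula} : Step A A' → Step (.ex s A) (.ex s A')

/-- The congruence `≡` generated by the rewrite rules. -/
def Formula.Congr (A B : Formula) : Prop := Relation.EqvGen Formula.Step A B

/-! ### Proof-terms and their reduction -/

/-- Proof-terms. `lam` binds a proof variable; each branch of `cases` binds a proof variable;
`tlam s` binds a term variable of sort `s`; `exElim s π π'` binds, in `π'`, a term variable of
sort `s` and a proof variable. -/
inductive PTerm : Type
  | var (a : ℕ) : PTerm
  | lam (π : PTerm) : PTerm
  | app (π π' : PTerm) : PTerm
  | pair (π π' : PTerm) : PTerm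
  | fst (π : PTerm) : PTerm
  | snd (π : PTerm) : PTerm
  | inl (π : PTerm) : PTerm
  | inr (π : PTerm) : PTerm
  | cases (π₁ π₂ π₃ : PTerm) : PTerm
  | triv : PTerm
  | botElim (π : PTerm) : PTerm
  | tlam (s : Srt) (π : PTerm) : PTerm
  | tapp (s : Srt) (π : PTerm) (t : Tm s) : PTerm
  | tpair (s : Srt) (t : Tm s) (π : PTerm) : PTerm
  | exElim (s : Srt) (π π' : PTerm) : PTerm

namespace PTerm

/-- Substitution of terms for the term variables of a proof-term. -/
def tsubst : PTerm → TSub → PTerm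
  | var a, _ => var a
  | lam π, σ => lam (π.tsubst σ)
  | app π π', σ => app (π.tsubst σ) (π'.tsubst σ)
  | pair π π', σ => pair (π.tsubst σ) (π'.tsubst σ)
  | fst π, σ => fst (π.tsubst σ)
  | snd π, σ => snd (π.tsubst σ)
  | inl π, σ => inl (π.tsubst σ)
  | inr π, σ => inr (π.tsubst σ)
  | cases π₁ π₂ π₃, σ => cases (π₁.tsubst σ) (π₂.tsubst σ) (π₃.tsubst σ)
  | triv, _ => triv
  | botElim π, σ => botElim (π.tsubst σ)
  | tlam s π, σ => tlam s (π.tsubst (TSub.up s σ))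
  | tapp s π t, σ => tapp s (π.tsubst σ) (t.subst σ)
  | tpair s t π, σ => tpair s (t.subst σ) (π.tsubst σ)
  | exElim s π π', σ => exElim s (π.tsubst σ) (π'.tsubst (TSub.up s σ))

/-- A renaming of proof variables pushed under a binder. -/
def upRen (r : ℕ → ℕ) : ℕ → ℕ
  | 0 => 0
  | a + 1 => r a + 1

/-- Renaming of the proof variables of a proof-term. -/
def rename : PTerm → (ℕ → ℕ) → PTerm
  | var a, r => var (r a)
  | lam π, r => lam (π.rename (upRen r))
  | app π π', r => app (π.rename r) (π'.rename r)
  | pair π π', r => pair (π.rename r) (π'.rename r)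
  | fst π, r => fst (π.rename r)
  | snd π, r => snd (π.rename r)
  | inl π, r => inl (π.rename r)
  | inr π, r => inr (π.rename r)
  | cases π₁ π₂ π₃, r =>
      cases (π₁.rename r) (π₂.rename (upRen r)) (π₃.rename (upRen r))
  | triv, _ => triv
  | botElim π, r => botElim (π.rename r)
  | tlam s π, r => tlam s (π.rename r)
  | tapp s π t, r => tapp s (π.rename r) t
  | tpair s t π, r => tpair s t (π.rename r)
  | exElim s π π', r => exElim s (π.rename r) (π'.rename (upRen r))

/-- A substitution of proof-terms pushed under a binder of a proof variable. -/
def up (ρ : ℕ → PTerm) : ℕ → PTerm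
  | 0 => var 0
  | a + 1 => (ρ a).rename Nat.succ

/-- A substitution of proof-terms pushed under a binder of a term variable of sort `s`. -/
def tup (s : Srt) (ρ : ℕ → PTerm) : ℕ → PTerm := fun a => (ρ a).tsubst (TSub.shift s)

/-- Substitution of proof-terms for the proof variables of a proof-term. -/
def subst : PTerm → (ℕ → PTerm) → PTerm
  | var a, ρ => ρ a
  | lam π, ρ => lam (π.subst (up ρ))
  | app π π', ρ => app (π.subst ρ) (π'.subst ρ)
  | pair π π', ρ => pair (π.subst ρ) (π'.subst ρ)
  | fst π, ρ => fst (π.subst ρ)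
  | snd π, ρ => snd (π.subst ρ)
  | inl π, ρ => inl (π.subst ρ)
  | inr π, ρ => inr (π.subst ρ)
  | cases π₁ π₂ π₃, ρ => cases (π₁.subst ρ) (π₂.subst (up ρ)) (π₃.subst (up ρ))
  | triv, _ => triv
  | botElim π, ρ => botElim (π.subst ρ)
  | tlam s π, ρ => tlam s (π.subst (tup s ρ))
  | tapp s π t, ρ => tapp s (π.subst ρ) t
  | tpair s t π, ρ => tpair s t (π.subst ρ)
  | exElim s π π', ρ => exElim s (π.subst ρ) (π'.subst (up (tup s ρ)))

/-- The substitution `(σ/α)`, where `α` is the proof variable `0`, whose binder is removed. -/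
def single (σ : PTerm) : ℕ → PTerm
  | 0 => σ
  | a + 1 => var a

/-- One-step reduction: the contextual closure of the cut elimination rules. -/
inductive Step : PTerm → PTerm → Prop
  | beta (π₁ π₂ : PTerm) : Step (app (lam π₁) π₂) (π₁.subst (single π₂))
  | tbeta (s : Srt) (π : PTerm) (t : Tm s) :
      Step (tapp s (tlam s π) t) (π.tsubst (TSub.single t))
  | fst_pair (π₁ π₂ : PTerm) : Step (fst (pair π₁ π₂)) π₁
  | snd_pair (π₁ π₂ : PTerm) : Step (snd (pair π₁ π₂)) π₂
  | cases_inl (π₁ π₂ π₃ : PTerm) : Step (cases (inl π₁) π₂ π₃) (π₂.subst (single π₁))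
  | cases_inr (π₁ π₂ π₃ : PTerm) : Step (cases (inr π₁) π₂ π₃) (π₃.subst (single π₁))
  | exElim_tpair (s : Srt) (t : Tm s) (π₁ π₂ : PTerm) :
      Step (exElim s (tpair s t π₁) π₂)
        ((π₂.tsubst (TSub.single t)).subst (single π₁))
  | lam {π π' : PTerm} : Step π π' → Step (lam π) (lam π')
  | app_left {π π' σ : PTerm} : Step π π' → Step (app π σ) (app π' σ)
  | app_right {σ π π' : PTerm} : Step π π' → Step (app σ π) (app σ π')
  | pair_left {π π' σ : PTerm} : Step π π' → Step (pair π σ) (pair π' σ)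
  | pair_right {σ π π' : PTerm} : Step π π' → Step (pair σ π) (pair σ π')
  | fst {π π' : PTerm} : Step π π' → Step (fst π) (fst π')
  | snd {π π' : PTerm} : Step π π' → Step (snd π) (snd π')
  | inl {π π' : PTerm} : Step π π' → Step (inl π) (inl π')
  | inr {π π' : PTerm} : Step π π' → Step (inr π) (inr π')
  | cases_fst {π π' σ₂ σ₃ : PTerm} : Step π π' → Step (cases π σ₂ σ₃) (cases π' σ₂ σ₃)
  | cases_snd {σ₁ π π' σ₃ : PTerm} : Step π π' → Step (cases σ₁ π σ₃) (cases σ₁ π' σ₃)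
  | cases_trd {σ₁ σ₂ π π' : PTerm} : Step π π' → Step (cases σ₁ σ₂ π) (cases σ₁ σ₂ π')
  | botElim {π π' : PTerm} : Step π π' → Step (botElim π) (botElim π')
  | tlam {s : Srt} {π π' : PTerm} : Step π π' → Step (tlam s π) (tlam s π')
  | tapp {s : Srt} {π π' : PTerm} {t : Tm s} : Step π π' → Step (tapp s π t) (tapp s π' t)
  | tpair {s : Srt} {t : Tm s} {π π' : PTerm} :
      Step π π' → Step (tpair s t π) (tpair s t π')
  | exElim_left {s : Srt} {π π' σ : PTerm} :
      Step π π' → Step (exElim s π σ) (exElim s π' σ)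
  | exElim_right {s : Srt} {σ π π' : PTerm} :
      Step π π' → Step (exElim s σ π) (exElim s σ π')

/-- `π` is strongly normalizable: every reduction sequence that starts from `π` is finite. -/
def StronglyNormalizable (π : PTerm) : Prop := Acc (fun π₂ π₁ => Step π₁ π₂) π

/-- `π` is cut-free, i.e. normal: no reduction rule applies anywhere in `π`. -/
def CutFree (π : PTerm) : Prop := ∀ π', ¬ Step π π'

end PTerm

/-! ### Natural deduction modulo -/

/-- `Proves Γ π A`: the proof-term `π` is a proof of the sequent `Γ ⊢ A` in natural deduction
modulo the congruence `≡` of `HA→`. The proof variable `a` denotes the hypothesis `Γ[a]`, and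
weakening by `shift s` expresses that the variable of sort `s` that is bound by the rule does not
occur free in the context (and, for `exElim`, in the conclusion). -/
inductive Proves : List Formula → PTerm → Formula → Prop
  | ax {Γ : List Formula} {a : ℕ} {A B : Formula} :
      Γ[a]? = some A → A.Congr B → Proves Γ (.var a) B
  | impI {Γ : List Formula} {π : PTerm} {A B C : Formula} :
      Proves (A :: Γ) π B → C.Congr (.imp A B) → Proves Γ (.lam π) C
  | impE {Γ : List Formula} {π π' : PTerm} {A B C : Formula} :
      Proves Γ π C → Proves Γ π' A → C.Congr (.imp A B) → Proves Γ (.app π π') B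
  | andI {Γ : List Formula} {π π' : PTerm} {A B C : Formula} :
      Proves Γ π A → Proves Γ π' B → C.Congr (.and A B) → Proves Γ (.pair π π') C
  | andE₁ {Γ : List Formula} {π : PTerm} {A B C : Formula} :
      Proves Γ π C → C.Congr (.and A B) → Proves Γ (.fst π) A
  | andE₂ {Γ : List Formula} {π : PTerm} {A B C : Formula} :
      Proves Γ π C → C.Congr (.and A B) → Proves Γ (.snd π) B
  | orI₁ {Γ : List Formula} {π : PTerm} {A B C : Formula} :
      Proves Γ π A → C.Congr (.or A B) → Proves Γ (.inl π) C
  | orI₂ {Γ : List Formula} {π : PTerm} {A B C : Formula} :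
      Proves Γ π B → C.Congr (.or A B) → Proves Γ (.inr π) C
  | orE {Γ : List Formula} {π₁ π₂ π₃ : PTerm} {A B C D : Formula} :
      Proves Γ π₁ D → Proves (A :: Γ) π₂ C → Proves (B :: Γ) π₃ C → D.Congr (.or A B) →
      Proves Γ (.cases π₁ π₂ π₃) C
  | topI {Γ : List Formula} {A : Formula} : A.Congr .top → Proves Γ .triv A
  | botE {Γ : List Formula} {π : PTerm} {A B : Formula} :
      Proves Γ π B → B.Congr .bot → Proves Γ (.botElim π) A
  | allI {Γ : List Formula} {s : Srt} {π : PTerm} {A B : Formula} :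
      Proves (Γ.map (Formula.shift s)) π A → B.Congr (.all s A) → Proves Γ (.tlam s π) B
  | allE {Γ : List Formula} {s : Srt} {π : PTerm} {A B C : Formula} (t : Tm s) :
      Proves Γ π B → B.Congr (.all s A) → C.Congr (A.subst (TSub.single t)) →
      Proves Γ (.tapp s π t) C
  | exI {Γ : List Formula} {s : Srt} {π : PTerm} {A B C : Formula} (t : Tm s) :
      Proves Γ π C → B.Congr (.ex s A) → C.Congr (A.subst (TSub.single t)) →
      Proves Γ (.tpair s t π) B
  | exE {Γ : List Formula} {s : Srt} {π π' : PTerm} {A B C : Formula} :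
      Proves Γ π C → Proves (A :: Γ.map (Formula.shift s)) π' (B.shift s) →
      C.Congr (.ex s A) → Proves Γ (.exElim s π π') B

end HAModulo

namespace HAModulo

/-! ### Algebra of term substitutions -/

/-! The theorem splits into subject reduction (`Proves.step`) and strong normalization
(`Proves.stronglyNormalizable`); a cut-free proof of the same sequent is then reached by reducing
until no step remains.

Subject reduction needs congruent propositions with the same head connective to have congruent
components: a cut joins an introduction and an elimination only through `≡`. This follows from
confluence of proposition rewriting. The rule for `N` does not terminate, so confluence comes from
the diamond property of a parallel reduction (`Par.diamond`) that treats terms up to conversion. All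
it needs from arithmetic is that `0` and `S(t)` are never convertible, which evaluation in ℕ shows.

Strong normalization uses a model whose truth values are reducibility candidates. Numbers denote
elements of ℕ, classes denote sequences of candidates, and quantifiers range over these denotations.
The model must give both sides of each rewrite rule the same value. Equality is interpreted by its
unfolding. A comprehension term denotes the sequence of values of its defining proposition. `Null`,
`⊤` and `⊥` all denote the strongly normalizable proof-terms, which suffices because `δ_⊥` has no
cut rule. The rule for `N` is circular, but `N` occurs positively in its own unfolding, so
Knaster–Tarski gives a fixed point `natC`.

Hence congruent propositions have equal denotations (`Formula.Congr.den_eq`), and an induction on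
derivations (`Proves.mem_den`) puts every proof in the candidate of its conclusion. Terms in proofs
are not tied to semantic values: the candidates for quantifiers treat the syntactic witness and the
semantic one as unrelated. -/

theorem ITerm.bind_var {V : Type} (t : ITerm V) : t.bind ITerm.var = t := by
  induction t <;> simp_all [ITerm.bind]

theorem ITerm.bind_bind {U V W : Type} (t : ITerm U) (σ : U → ITerm V) (τ : V → ITerm W) :
    (t.bind σ).bind τ = t.bind (fun v => (σ v).bind τ) := by
  induction t <;> simp_all [ITerm.bind]

/-- Composition of substitutions: first `σ`, then `τ`. -/
def TSub.comp (σ τ : TSub) : TSub :=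
  ⟨fun v => (σ.num v).bind τ.num, fun v => (σ.cls v).bind τ⟩

theorem TSub.ext' {σ τ : TSub} (h₁ : ∀ v, σ.num v = τ.num v) (h₂ : ∀ v, σ.cls v = τ.cls v) :
    σ = τ := by
  cases σ; cases τ
  simp only [TSub.mk.injEq]
  exact ⟨funext h₁, funext h₂⟩

theorem KTerm.bind_id (p : KTerm) : p.bind TSub.id = p := by
  cases p with
  | var v => rfl
  | cls P ts => simp [KTerm.bind, TSub.id, ITerm.bind_var]

theorem KTerm.bind_bind (p : KTerm) (σ τ : TSub) :
    (p.bind σ).bind τ = p.bind (σ.comp τ) := by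
  cases p with
  | var v => rfl
  | cls P ts => simp [KTerm.bind, TSub.comp, ITerm.bind_bind]

theorem Tm.subst_id {s : Srt} (t : Tm s) : t.subst TSub.id = t := by
  cases t with
  | num t => simp [Tm.subst, TSub.id, ITerm.bind_var]
  | cls p => simp [Tm.subst, KTerm.bind_id]

theorem Tm.subst_subst {s : Srt} (t : Tm s) (σ τ : TSub) :
    (t.subst σ).subst τ = t.subst (σ.comp τ) := by
  cases t with
  | num t => simp [Tm.subst, TSub.comp, ITerm.bind_bind]
  | cls p => simp [Tm.subst, KTerm.bind_bind]

theorem TSub.comp_assoc (σ τ υ : TSub) : (σ.comp τ).comp υ = σ.comp (τ.comp υ) :=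
  TSub.ext' (fun _ => ITerm.bind_bind _ _ _) (fun _ => KTerm.bind_bind _ _ _)

theorem TSub.comp_id (σ : TSub) : σ.comp TSub.id = σ :=
  TSub.ext' (fun _ => ITerm.bind_var _) (fun _ => KTerm.bind_id _)

theorem TSub.id_comp (σ : TSub) : TSub.id.comp σ = σ := rfl

theorem TSub.up_eq (s : Srt) (σ : TSub) :
    σ.up s = TSub.cons (Tm.var s 0) (σ.comp (TSub.shift s)) := rfl

theorem TSub.cons_comp {s : Srt} (t : Tm s) (σ τ : TSub) :
    (TSub.cons t σ).comp τ = TSub.cons (t.subst τ) (σ.comp τ) := by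
  cases t <;> refine TSub.ext' (fun v => ?_) (fun v => ?_) <;> first | rfl | (cases v <;> rfl)

theorem TSub.shift_comp_cons {s : Srt} (t : Tm s) (σ : TSub) :
    (TSub.shift s).comp (TSub.cons t σ) = σ := by
  cases t <;> rfl

theorem TSub.cons_var_shift (s : Srt) : TSub.cons (Tm.var s 0) (TSub.shift s) = TSub.id := by
  cases s <;> refine TSub.ext' (fun v => ?_) (fun v => ?_) <;> first | rfl | (cases v <;> rfl)

theorem Tm.var_subst_cons {s : Srt} (t : Tm s) (σ : TSub) :
    (Tm.var s 0).subst (TSub.cons t σ) = t := by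
  cases t <;> rfl

theorem TSub.up_id (s : Srt) : TSub.id.up s = TSub.id := by
  rw [TSub.up_eq, TSub.id_comp, TSub.cons_var_shift]

/-- The shift inside `up` is undone by the new head of `cons`; the later laws for composing and
instantiating under binders come from this cancellation. -/
theorem TSub.up_comp_cons {s : Srt} (t : Tm s) (σ τ : TSub) :
    (σ.up s).comp (TSub.cons t τ) = TSub.cons t (σ.comp τ) := by
  rw [TSub.up_eq, TSub.cons_comp, TSub.comp_assoc, TSub.shift_comp_cons, Tm.var_subst_cons]

theorem TSub.shift_comp_up (s : Srt) (σ : TSub) :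
    (TSub.shift s).comp (σ.up s) = σ.comp (TSub.shift s) :=
  TSub.shift_comp_cons _ _

theorem TSub.up_comp_up (s : Srt) (σ τ : TSub) :
    (σ.up s).comp (τ.up s) = (σ.comp τ).up s := by
  rw [TSub.up_eq s τ, TSub.up_comp_cons, ← TSub.comp_assoc, ← TSub.up_eq]

theorem TSub.up_comp_single {s : Srt} (t : Tm s) (σ : TSub) :
    (σ.up s).comp (TSub.single t) = TSub.cons t σ := by
  rw [TSub.single, TSub.up_comp_cons, TSub.comp_id]

theorem TSub.single_comp {s : Srt} (t : Tm s) (σ : TSub) :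
    (TSub.single t).comp σ = TSub.cons (t.subst σ) σ := by
  rw [TSub.single, TSub.cons_comp, TSub.id_comp]

theorem TSub.shift_comp_single {s : Srt} (t : Tm s) :
    (TSub.shift s).comp (TSub.single t) = TSub.id :=
  TSub.shift_comp_cons _ _

/-! ### Substitution in propositions -/

theorem Formula.subst_id (A : Formula) : A.subst TSub.id = A := by
  induction A with
  | eq t u => simp [Formula.subst, TSub.id, ITerm.bind_var]
  | null t => simp [Formula.subst, TSub.id, ITerm.bind_var]
  | nat t => simp [Formula.subst, TSub.id, ITerm.bind_var]
  | mem t p =>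
    rw [Formula.subst, KTerm.bind_id]
    simp [TSub.id, ITerm.bind_var]
  | top => rfl
  | bot => rfl
  | imp A B ihA ihB => rw [Formula.subst, ihA, ihB]
  | and A B ihA ihB => rw [Formula.subst, ihA, ihB]
  | or A B ihA ihB => rw [Formula.subst, ihA, ihB]
  | all s A ih => rw [Formula.subst, TSub.up_id, ih]
  | ex s A ih => rw [Formula.subst, TSub.up_id, ih]

theorem Formula.subst_subst (A : Formula) (σ τ : TSub) :
    (A.subst σ).subst τ = A.subst (σ.comp τ) := by
  induction A generalizing σ τ with
  | eq t u => simp [Formula.subst, TSub.comp, ITerm.bind_bind]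
  | null t => simp [Formula.subst, TSub.comp, ITerm.bind_bind]
  | nat t => simp [Formula.subst, TSub.comp, ITerm.bind_bind]
  | mem t p =>
    rw [Formula.subst, Formula.subst, KTerm.bind_bind, ITerm.bind_bind]
    rfl
  | top => rfl
  | bot => rfl
  | imp A B ihA ihB => simp only [Formula.subst, ihA, ihB]
  | and A B ihA ihB => simp only [Formula.subst, ihA, ihB]
  | or A B ihA ihB => simp only [Formula.subst, ihA, ihB]
  | all s A ih => simp only [Formula.subst, ih, TSub.up_comp_up]
  | ex s A ih => simp only [Formula.subst, ih, TSub.up_comp_up]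

theorem Formula.shift_subst_up (s : Srt) (A : Formula) (σ : TSub) :
    (A.shift s).subst (σ.up s) = (A.subst σ).shift s := by
  rw [Formula.shift, Formula.shift, Formula.subst_subst, Formula.subst_subst, TSub.shift_comp_up]

theorem Formula.shift_subst_single {s : Srt} (A : Formula) (t : Tm s) :
    (A.shift s).subst (TSub.single t) = A := by
  rw [Formula.shift, Formula.subst_subst, TSub.shift_comp_single, Formula.subst_id]

theorem Formula.subst_single_subst {s : Srt} (A : Formula) (t : Tm s) (σ : TSub) :
    (A.subst (TSub.single t)).subst σ = (A.subst (σ.up s)).subst (TSub.single (t.subst σ)) := by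
  rw [Formula.subst_subst, Formula.subst_subst, TSub.single_comp, TSub.up_comp_single]

theorem NFormula.inst_subst {n : ℕ} (P : NFormula n) (τ : Fin n → ITerm ℕ) (σ : TSub) :
    (P.inst τ).subst σ = P.inst (fun i => (τ i).bind σ.num) := by
  have key : ∀ {n : ℕ} (τ : Fin n → ITerm ℕ) (σ : TSub),
      (fun i : Fin (n + 1) => ((Fin.cons (.var 0)
        (fun i => (τ i).bind (fun v => .var (v + 1))) : Fin (n + 1) → ITerm ℕ) i).bind
          (σ.up .iota).num) =
      Fin.cons (.var 0) (fun i => ((τ i).bind σ.num).bind (fun v => .var (v + 1))) := by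
    intro n τ σ
    funext i
    refine Fin.cases rfl (fun i => ?_) i
    simp only [Fin.cons_succ, ITerm.bind_bind]
    rfl
  induction P generalizing σ with
  | eq t u => simp [NFormula.inst, Formula.subst, ITerm.bind_bind]
  | null t => simp [NFormula.inst, Formula.subst, ITerm.bind_bind]
  | nat t => simp [NFormula.inst, Formula.subst, ITerm.bind_bind]
  | top => rfl
  | bot => rfl
  | imp A B ihA ihB => simp only [NFormula.inst, Formula.subst, ihA, ihB]
  | and A B ihA ihB => simp only [NFormula.inst, Formula.subst, ihA, ihB]
  | or A B ihA ihB => simp only [NFormula.inst, Formula.subst, ihA, ihB]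
  | all A ih => simp only [NFormula.inst, Formula.subst, ih, key]
  | ex A ih => simp only [NFormula.inst, Formula.subst, ih, key]

/-! ### Substitution in proof-terms -/

namespace PTerm

theorem tsubst_id (π : PTerm) : π.tsubst TSub.id = π := by
  induction π <;> simp_all [tsubst, TSub.up_id, Tm.subst_id]

theorem tsubst_tsubst (π : PTerm) (σ τ : TSub) :
    (π.tsubst σ).tsubst τ = π.tsubst (σ.comp τ) := by
  induction π generalizing σ τ <;> simp_all [tsubst, TSub.up_comp_up, Tm.subst_subst]

/-- Proof variables and term variables live in separate index spaces, so the two operations do not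
interact. -/
theorem rename_tsubst (π : PTerm) (r : ℕ → ℕ) (σ : TSub) :
    (π.rename r).tsubst σ = (π.tsubst σ).rename r := by
  induction π generalizing r σ <;> simp_all [tsubst, rename]

theorem upRen_comp (r r' : ℕ → ℕ) : (fun a => upRen r' (upRen r a)) = upRen (fun a => r' (r a)) := by
  funext a; cases a <;> rfl

theorem rename_rename (π : PTerm) (r r' : ℕ → ℕ) :
    (π.rename r).rename r' = π.rename (fun a => r' (r a)) := by
  induction π generalizing r r' <;> simp_all [rename, upRen_comp]

theorem up_upRen (r : ℕ → ℕ) (ρ : ℕ → PTerm) :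
    (fun a => up ρ (upRen r a)) = up (fun a => ρ (r a)) := by
  funext a; cases a <;> rfl

theorem tup_comp_ren (s : Srt) (r : ℕ → ℕ) (ρ : ℕ → PTerm) :
    (fun a => tup s ρ (r a)) = tup s (fun a => ρ (r a)) := rfl

/-- Composition of substitutions is built in stages: crossing a proof binder renames and crossing a
term binder shifts, so `subst_subst` first needs the laws relating substitution to `rename` and
`tsubst`. -/
theorem rename_subst (π : PTerm) (r : ℕ → ℕ) (ρ : ℕ → PTerm) :
    (π.rename r).subst ρ = π.subst (fun a => ρ (r a)) := by
  induction π generalizing r ρ <;> simp_all [rename, subst, up_upRen, tup_comp_ren]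

theorem rename_up (r : ℕ → ℕ) (ρ : ℕ → PTerm) :
    (fun a => (up ρ a).rename (upRen r)) = up (fun a => (ρ a).rename r) := by
  funext a
  cases a with
  | zero => rfl
  | succ a => simp only [up, rename_rename]; rfl

theorem rename_tup (s : Srt) (r : ℕ → ℕ) (ρ : ℕ → PTerm) :
    (fun a => (tup s ρ a).rename r) = tup s (fun a => (ρ a).rename r) := by
  funext a
  simp only [tup, rename_tsubst]

theorem subst_rename (π : PTerm) (ρ : ℕ → PTerm) (r : ℕ → ℕ) :
    (π.subst ρ).rename r = π.subst (fun a => (ρ a).rename r) := by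
  induction π generalizing r ρ <;> simp_all [rename, subst, rename_up, rename_tup]

theorem tsubst_up (ρ : ℕ → PTerm) (σ : TSub) :
    (fun a => (up ρ a).tsubst σ) = up (fun a => (ρ a).tsubst σ) := by
  funext a
  cases a with
  | zero => rfl
  | succ a => simp only [up, rename_tsubst]

theorem tsubst_tup (s : Srt) (ρ : ℕ → PTerm) (σ : TSub) :
    (fun a => (tup s ρ a).tsubst (σ.up s)) = tup s (fun a => (ρ a).tsubst σ) := by
  funext a
  simp only [tup, tsubst_tsubst, TSub.shift_comp_up]

theorem subst_tsubst (π : PTerm) (ρ : ℕ → PTerm) (σ : TSub) :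
    (π.subst ρ).tsubst σ = (π.tsubst σ).subst (fun a => (ρ a).tsubst σ) := by
  induction π generalizing ρ σ <;> simp_all [tsubst, subst, tsubst_up, tsubst_tup]

theorem subst_up (ρ ρ' : ℕ → PTerm) :
    (fun a => (up ρ a).subst (up ρ')) = up (fun a => (ρ a).subst ρ') := by
  funext a
  cases a with
  | zero => rfl
  | succ a => simp only [up, rename_subst, subst_rename]

theorem subst_tup (s : Srt) (ρ ρ' : ℕ → PTerm) :
    (fun a => (tup s ρ a).subst (tup s ρ')) = tup s (fun a => (ρ a).subst ρ') := by
  funext a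
  simp only [tup, subst_tsubst]
  rfl

theorem subst_subst (π : PTerm) (ρ ρ' : ℕ → PTerm) :
    (π.subst ρ).subst ρ' = π.subst (fun a => (ρ a).subst ρ') := by
  induction π generalizing ρ ρ' <;> simp_all [subst, subst_up, subst_tup]

theorem up_var : up var = var := by
  funext a; cases a <;> rfl

theorem tup_var (s : Srt) : tup s var = var := rfl

theorem subst_var (π : PTerm) : π.subst var = π := by
  induction π <;> simp_all [subst, up_var, tup_var]

/-- The substitution that maps the proof variable `0` to `π` and `a + 1` to `ρ a`. -/
def consSub (π : PTerm) (ρ : ℕ → PTerm) : ℕ → PTerm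
  | 0 => π
  | a + 1 => ρ a

theorem subst_up_single (π : PTerm) (ρ : ℕ → PTerm) (σ : PTerm) :
    (π.subst (up ρ)).subst (single σ) = π.subst (consSub σ ρ) := by
  rw [subst_subst]
  congr 1
  funext a
  cases a with
  | zero => rfl
  | succ a =>
    simp only [up, rename_subst, consSub]
    exact subst_var _

theorem single_subst (π σ : PTerm) (ρ : ℕ → PTerm) :
    (π.subst (single σ)).subst ρ = (π.subst (up ρ)).subst (single (σ.subst ρ)) := by
  rw [subst_up_single, subst_subst]
  congr 1
  funext a
  cases a <;> rfl

theorem single_tsubst (π σ : PTerm) (τ : TSub) :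
    (π.subst (single σ)).tsubst τ = (π.tsubst τ).subst (single (σ.tsubst τ)) := by
  rw [subst_tsubst]
  congr 1
  funext a
  cases a <;> rfl

theorem tsubst_single_tsubst {s : Srt} (π : PTerm) (t : Tm s) (σ : TSub) :
    (π.tsubst (TSub.single t)).tsubst σ =
      (π.tsubst (σ.up s)).tsubst (TSub.single (t.subst σ)) := by
  rw [tsubst_tsubst, tsubst_tsubst, TSub.single_comp, TSub.up_comp_single]

theorem subst_tup_single {s : Srt} (π : PTerm) (ρ : ℕ → PTerm) (t : Tm s) :
    (π.subst (tup s ρ)).tsubst (TSub.single t) = (π.tsubst (TSub.single t)).subst ρ := by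
  rw [subst_tsubst]
  congr 1
  funext a
  simp only [tup, tsubst_tsubst, TSub.shift_comp_single, tsubst_id]

/-! ### Reduction and substitution -/

theorem Step.subst {π π' : PTerm} (h : Step π π') (ρ : ℕ → PTerm) :
    Step (π.subst ρ) (π'.subst ρ) := by
  induction h generalizing ρ with
  | beta π₁ π₂ => rw [single_subst]; exact .beta _ _
  | tbeta s π t => rw [← subst_tup_single]; exact .tbeta _ _ _
  | cases_inl π₁ π₂ π₃ => rw [single_subst]; exact .cases_inl _ _ _
  | cases_inr π₁ π₂ π₃ => rw [single_subst]; exact .cases_inr _ _ _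
  | exElim_tpair s t π₁ π₂ =>
    rw [single_subst, ← subst_tup_single]
    -- The second premise of `exElim` lies under both kinds of binder, whose liftings commute.
    have e : tup s (up ρ) = up (tup s ρ) := tsubst_up ρ _
    rw [e]
    exact .exElim_tpair _ _ _ _
  | _ => constructor <;> solve_by_elim

theorem Step.tsubst {π π' : PTerm} (h : Step π π') (σ : TSub) :
    Step (π.tsubst σ) (π'.tsubst σ) := by
  induction h generalizing σ with
  | beta π₁ π₂ => rw [single_tsubst]; exact .beta _ _
  | tbeta s π t => rw [tsubst_single_tsubst]; exact .tbeta _ _ _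
  | cases_inl π₁ π₂ π₃ => rw [single_tsubst]; exact .cases_inl _ _ _
  | cases_inr π₁ π₂ π₃ => rw [single_tsubst]; exact .cases_inr _ _ _
  | exElim_tpair s t π₁ π₂ =>
    rw [single_tsubst, tsubst_single_tsubst]
    exact .exElim_tpair _ _ _ _
  | _ => constructor <;> solve_by_elim

end PTerm

theorem eqvGen_map {α β : Type*} {r : α → α → Prop} {s : β → β → Prop} (f : α → β)
    (hf : ∀ a b, r a b → Relation.EqvGen s (f a) (f b)) {a b : α} (h : Relation.EqvGen r a b) :
    Relation.EqvGen s (f a) (f b) := by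
  induction h with
  | rel a b h => exact hf a b h
  | refl a => exact .refl _
  | symm a b _ ih => exact .symm _ _ ih
  | trans a b c _ _ ih₁ ih₂ => exact .trans _ _ _ ih₁ ih₂

/-! ### Conversion of terms -/

/-- The congruence on terms of sort `ι` generated by the rewrite rules. -/
def ITerm.Conv (t u : ITerm ℕ) : Prop := Relation.EqvGen ITerm.Step t u

namespace ITerm

theorem Conv.refl (t : ITerm ℕ) : Conv t t := Relation.EqvGen.refl t

theorem Conv.symm {t u : ITerm ℕ} (h : Conv t u) : Conv u t := Relation.EqvGen.symm _ _ h

theorem Conv.trans {t u v : ITerm ℕ} (h : Conv t u) (h' : Conv u v) : Conv t v :=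
  Relation.EqvGen.trans _ _ _ h h'

theorem Step.bind {t u : ITerm ℕ} (h : Step t u) (σ : ℕ → ITerm ℕ) :
    Step (t.bind σ) (u.bind σ) := by
  induction h <;> constructor <;> assumption

theorem Conv.bind {t u : ITerm ℕ} (h : Conv t u) (σ : ℕ → ITerm ℕ) :
    Conv (t.bind σ) (u.bind σ) :=
  eqvGen_map (fun t : ITerm ℕ => t.bind σ) (fun _ _ h => .rel _ _ (h.bind σ)) h

theorem Conv.succ {t u : ITerm ℕ} (h : Conv t u) : Conv (.succ t) (.succ u) :=
  eqvGen_map ITerm.succ (fun _ _ h => .rel _ _ (.succ h)) h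

theorem Conv.pred {t u : ITerm ℕ} (h : Conv t u) : Conv (.pred t) (.pred u) :=
  eqvGen_map ITerm.pred (fun _ _ h => .rel _ _ (.pred h)) h

theorem Conv.add {t t' u u' : ITerm ℕ} (h : Conv t t') (h' : Conv u u') :
    Conv (.add t u) (.add t' u') :=
  Relation.EqvGen.trans _ _ _
    (eqvGen_map (fun t => ITerm.add t u) (fun _ _ h => .rel _ _ (.add_left h)) h)
    (eqvGen_map (fun u => ITerm.add t' u) (fun _ _ h => .rel _ _ (.add_right h)) h')

theorem Conv.mul {t t' u u' : ITerm ℕ} (h : Conv t t') (h' : Conv u u') :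
    Conv (.mul t u) (.mul t' u') :=
  Relation.EqvGen.trans _ _ _
    (eqvGen_map (fun t => ITerm.mul t u) (fun _ _ h => .rel _ _ (.mul_left h)) h)
    (eqvGen_map (fun u => ITerm.mul t' u) (fun _ _ h => .rel _ _ (.mul_right h)) h')

theorem bind_conv {V : Type} (t : ITerm V) {σ τ : V → ITerm ℕ} (h : ∀ v, Conv (σ v) (τ v)) :
    Conv (t.bind σ) (t.bind τ) := by
  induction t with
  | var v => exact h v
  | zero => exact .refl _
  | succ t ih => exact ih.succ
  | pred t ih => exact ih.pred
  | add t u iht ihu => exact iht.add ihu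
  | mul t u iht ihu => exact iht.mul ihu

/-- The value of a term in the standard model. -/
def val {V : Type} : ITerm V → (V → ℕ) → ℕ
  | .var v, e => e v
  | .zero, _ => 0
  | .succ t, e => t.val e + 1
  | .pred t, e => t.val e - 1
  | .add t u, e => t.val e + u.val e
  | .mul t u, e => t.val e * u.val e

theorem val_bind {V W : Type} (t : ITerm V) (σ : V → ITerm W) (e : W → ℕ) :
    (t.bind σ).val e = t.val (fun v => (σ v).val e) := by
  induction t <;> simp_all [bind, val]

/-- The rule `Pred(0) → 0` is sound because subtraction on ℕ is truncated. -/
theorem Step.val_eq {t u : ITerm ℕ} (h : Step t u) (e : ℕ → ℕ) : t.val e = u.val e := by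
  induction h <;> simp_all [val] <;> ring

theorem Conv.val_eq {t u : ITerm ℕ} (h : Conv t u) (e : ℕ → ℕ) : t.val e = u.val e := by
  induction h with
  | rel a b h => exact h.val_eq e
  | refl a => rfl
  | symm a b _ ih => exact ih.symm
  | trans a b c _ _ ih₁ ih₂ => exact ih₁.trans ih₂

/-- Soundness in ℕ takes the place of a confluence proof for term rewriting; it excludes the only
conflict between rules, the one between the two rules for `Null`. -/
theorem not_zero_conv_succ (t : ITerm ℕ) : ¬ Conv .zero (.succ t) := by
  intro h
  have := h.val_eq (fun _ => 0)
  simp [val] at this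

end ITerm

/-- Terms of sort `κ` with convertible arguments. -/
inductive KTerm.Conv : KTerm → KTerm → Prop
  | var (v : ℕ) : Conv (.var v) (.var v)
  | cls {n : ℕ} (P : NFormula (n + 1)) {ts us : Fin n → ITerm ℕ} :
      (∀ i, ITerm.Conv (ts i) (us i)) → Conv (.cls P ts) (.cls P us)

namespace KTerm

theorem Conv.refl (p : KTerm) : Conv p p := by
  cases p with
  | var v => exact .var v
  | cls P ts => exact .cls P fun i => .refl _

theorem Conv.symm {p q : KTerm} (h : Conv p q) : Conv q p := by
  cases h with
  | var v => exact .var v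
  | cls P h => exact .cls P fun i => (h i).symm

theorem Conv.trans {p q r : KTerm} (h : Conv p q) (h' : Conv q r) : Conv p r := by
  cases h with
  | var v => exact h'
  | cls P h => cases h' with | cls _ h' => exact .cls P fun i => (h i).trans (h' i)

theorem Step.conv {p q : KTerm} (h : Step p q) : Conv p q := by
  cases h with
  | arg P ts i h =>
    refine .cls P fun j => ?_
    by_cases hj : j = i
    · subst hj
      rw [Function.update_self]
      exact Relation.EqvGen.rel _ _ h
    · rw [Function.update_of_ne hj]; exact .refl _

theorem Step.bind {p q : KTerm} (h : Step p q) (σ : TSub) : Step (p.bind σ) (q.bind σ) := by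
  cases h with
  | @arg n P ts i t' h =>
    have := Step.arg P (fun j => (ts j).bind σ.num) i (h.bind σ.num)
    have e : (fun j => (Function.update ts i t' j).bind σ.num) =
        Function.update (fun j => (ts j).bind σ.num) i (t'.bind σ.num) :=
      funext fun j => Function.apply_update (fun _ (t : ITerm ℕ) => t.bind σ.num) ts i t' j
    simpa only [KTerm.bind, e] using this

/-- A rewrite step touches a single argument, so the arguments are exchanged one at a time, along a
growing finite set of positions. -/
theorem Conv.eqvGen {p q : KTerm} (h : Conv p q) : Relation.EqvGen Step p q := by
  cases h with
  | var v => exact .refl _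
  | @cls n P ts us h =>
    have key : ∀ s : Finset (Fin n),
        Relation.EqvGen Step (.cls P ts) (.cls P fun i => if i ∈ s then us i else ts i) := by
      intro s
      induction s using Finset.induction_on with
      | empty => simpa using Relation.EqvGen.refl _
      | insert a s ha ih =>
        refine .trans _ _ _ ih ?_
        set ws : Fin n → ITerm ℕ := fun i => if i ∈ s then us i else ts i with hws
        have e₁ : (fun i => if i ∈ insert a s then us i else ts i) =
            Function.update ws a (us a) := by
          funext j
          by_cases hj : j = a
          · subst hj; simp
          · simp [hj, hws]
        -- As a trivial update at `a`, the starting family has the same form as the target, and the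
        -- conversion `h a` can be transported along one map.
        have e₂ : ws = Function.update ws a (ts a) := by
          funext j
          by_cases hj : j = a
          · subst hj; simp [hws, ha]
          · simp [hj]
        rw [e₁]
        nth_rewrite 1 [e₂]
        refine eqvGen_map (fun t => KTerm.cls P (Function.update ws a t)) (fun t u htu => ?_) (h a)
        have := Step.arg P (Function.update ws a t) a (t' := u) (by simpa using htu)
        rw [Function.update_idem] at this
        exact .rel _ _ this
    simpa using key Finset.univ

end KTerm

/-! ### The congruence on propositions -/

namespace Formula

theorem Congr.refl (A : Formula) : Congr A A := Relation.EqvGen.refl A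

theorem Congr.symm {A B : Formula} (h : Congr A B) : Congr B A := Relation.EqvGen.symm _ _ h

theorem Congr.trans {A B C : Formula} (h : Congr A B) (h' : Congr B C) : Congr A C :=
  Relation.EqvGen.trans _ _ _ h h'

theorem Step.subst {A B : Formula} (h : Step A B) (σ : TSub) :
    Step (A.subst σ) (B.subst σ) := by
  induction h generalizing σ with
  | eq_rule y z =>
    -- A class binder leaves the number variables alone.
    have e : ∀ t : ITerm ℕ, t.bind (σ.up .kappa).num = t.bind σ.num := fun t => by
      congr 1; exact funext fun v => ITerm.bind_var _
    simp only [Formula.subst, eqBody, e]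
    exact .eq_rule _ _
  | nat_rule n =>
    have e : ∀ t : ITerm ℕ, t.bind (σ.up .kappa).num = t.bind σ.num := fun t => by
      congr 1; exact funext fun v => ITerm.bind_var _
    simp only [Formula.subst, natBody, e]
    exact .nat_rule _
  | @mem_cls n x P ts =>
    rw [NFormula.inst_subst]
    have e : (fun i => ((Fin.cons x ts : Fin (n + 1) → ITerm ℕ) i).bind σ.num) =
        Fin.cons (x.bind σ.num) (fun i => (ts i).bind σ.num) := by
      funext i; refine Fin.cases rfl (fun i => rfl) i
    rw [e]
    exact .mem_cls _ _ _
  | null_zero => exact .null_zero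
  | null_succ x => exact .null_succ _
  | eq_left h => exact .eq_left (h.bind _)
  | eq_right h => exact .eq_right (h.bind _)
  | null h => exact .null (h.bind _)
  | nat h => exact .nat (h.bind _)
  | mem_left h => exact .mem_left (h.bind _)
  | mem_right h => exact .mem_right (h.bind _)
  | imp_left _ ih => exact .imp_left (ih σ)
  | imp_right _ ih => exact .imp_right (ih σ)
  | and_left _ ih => exact .and_left (ih σ)
  | and_right _ ih => exact .and_right (ih σ)
  | or_left _ ih => exact .or_left (ih σ)
  | or_right _ ih => exact .or_right (ih σ)
  | all _ ih => exact .all (ih _)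
  | ex _ ih => exact .ex (ih _)

theorem Congr.subst {A B : Formula} (h : Congr A B) (σ : TSub) :
    Congr (A.subst σ) (B.subst σ) :=
  eqvGen_map (fun A : Formula => A.subst σ) (fun _ _ h => .rel _ _ (h.subst σ)) h

theorem Congr.imp {A A' B B' : Formula} (h : Congr A A') (h' : Congr B B') :
    Congr (.imp A B) (.imp A' B') :=
  Relation.EqvGen.trans _ _ _
    (eqvGen_map (fun A => Formula.imp A B) (fun _ _ h => .rel _ _ (.imp_left h)) h)
    (eqvGen_map (fun B => Formula.imp A' B) (fun _ _ h => .rel _ _ (.imp_right h)) h')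

theorem Congr.and {A A' B B' : Formula} (h : Congr A A') (h' : Congr B B') :
    Congr (.and A B) (.and A' B') :=
  Relation.EqvGen.trans _ _ _
    (eqvGen_map (fun A => Formula.and A B) (fun _ _ h => .rel _ _ (.and_left h)) h)
    (eqvGen_map (fun B => Formula.and A' B) (fun _ _ h => .rel _ _ (.and_right h)) h')

theorem Congr.or {A A' B B' : Formula} (h : Congr A A') (h' : Congr B B') :
    Congr (.or A B) (.or A' B') :=
  Relation.EqvGen.trans _ _ _
    (eqvGen_map (fun A => Formula.or A B) (fun _ _ h => .rel _ _ (.or_left h)) h)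
    (eqvGen_map (fun B => Formula.or A' B) (fun _ _ h => .rel _ _ (.or_right h)) h')

theorem Congr.all {s : Srt} {A A' : Formula} (h : Congr A A') : Congr (.all s A) (.all s A') :=
  eqvGen_map (Formula.all s) (fun _ _ h => .rel _ _ (.all h)) h

theorem Congr.ex {s : Srt} {A A' : Formula} (h : Congr A A') : Congr (.ex s A) (.ex s A') :=
  eqvGen_map (Formula.ex s) (fun _ _ h => .rel _ _ (.ex h)) h

theorem congr_eq {t t' u u' : ITerm ℕ} (h : t.Conv t') (h' : u.Conv u') :
    Congr (.eq t u) (.eq t' u') :=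
  Relation.EqvGen.trans _ _ _
    (eqvGen_map (fun t => Formula.eq t u) (fun _ _ h => .rel _ _ (.eq_left h)) h)
    (eqvGen_map (fun u => Formula.eq t' u) (fun _ _ h => .rel _ _ (.eq_right h)) h')

theorem congr_null {t t' : ITerm ℕ} (h : t.Conv t') : Congr (.null t) (.null t') :=
  eqvGen_map Formula.null (fun _ _ h => .rel _ _ (.null h)) h

theorem congr_nat {t t' : ITerm ℕ} (h : t.Conv t') : Congr (.nat t) (.nat t') :=
  eqvGen_map Formula.nat (fun _ _ h => .rel _ _ (.nat h)) h

theorem congr_mem {t t' : ITerm ℕ} {p p' : KTerm} (h : t.Conv t') (h' : p.Conv p') :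
    Congr (.mem t p) (.mem t' p') :=
  Relation.EqvGen.trans _ _ _
    (eqvGen_map (fun t => Formula.mem t p) (fun _ _ h => .rel _ _ (.mem_left h)) h)
    (eqvGen_map (fun p => Formula.mem t' p) (fun _ _ h => .rel _ _ (.mem_right h)) h'.eqvGen)

/-! ### Confluence -/

/-- Parallel reduction of propositions, in which terms are taken up to conversion. -/
inductive Par : Formula → Formula → Prop
  | eq {t t' u u' : ITerm ℕ} : t.Conv t' → u.Conv u' → Par (.eq t u) (.eq t' u')
  | eq_rule {t t' u u' : ITerm ℕ} : t.Conv t' → u.Conv u' → Par (.eq t u) (eqBody t' u')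
  | null {t t' : ITerm ℕ} : t.Conv t' → Par (.null t) (.null t')
  | null_zero {t : ITerm ℕ} : t.Conv .zero → Par (.null t) .top
  | null_succ {t u : ITerm ℕ} : t.Conv (.succ u) → Par (.null t) .bot
  | nat {t t' : ITerm ℕ} : t.Conv t' → Par (.nat t) (.nat t')
  | nat_rule {t t' : ITerm ℕ} : t.Conv t' → Par (.nat t) (natBody t')
  | mem {t t' : ITerm ℕ} {p p' : KTerm} : t.Conv t' → p.Conv p' → Par (.mem t p) (.mem t' p')
  | mem_cls {t t' : ITerm ℕ} {n : ℕ} (P : NFormula (n + 1)) {ts us : Fin n → ITerm ℕ} :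
      t.Conv t' → (∀ i, (ts i).Conv (us i)) →
      Par (.mem t (.cls P ts)) (P.inst (Fin.cons t' us))
  | top : Par .top .top
  | bot : Par .bot .bot
  | imp {A A' B B' : Formula} : Par A A' → Par B B' → Par (.imp A B) (.imp A' B')
  | and {A A' B B' : Formula} : Par A A' → Par B B' → Par (.and A B) (.and A' B')
  | or {A A' B B' : Formula} : Par A A' → Par B B' → Par (.or A B) (.or A' B')
  | all {s : Srt} {A A' : Formula} : Par A A' → Par (.all s A) (.all s A')
  | ex {s : Srt} {A A' : Formula} : Par A A' → Par (.ex s A) (.ex s A')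

theorem Par.refl (A : Formula) : Par A A := by
  induction A with
  | eq t u => exact .eq (.refl _) (.refl _)
  | null t => exact .null (.refl _)
  | nat t => exact .nat (.refl _)
  | mem t p => exact .mem (.refl _) (.refl _)
  | top => exact .top
  | bot => exact .bot
  | imp A B ihA ihB => exact .imp ihA ihB
  | and A B ihA ihB => exact .and ihA ihB
  | or A B ihA ihB => exact .or ihA ihB
  | all s A ih => exact .all ih
  | ex s A ih => exact .ex ih

theorem Step.par {A B : Formula} (h : Step A B) : Par A B := by
  induction h with
  | eq_rule y z => exact .eq_rule (.refl _) (.refl _)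
  | nat_rule n => exact .nat_rule (.refl _)
  | mem_cls x P ts => exact .mem_cls P (.refl _) fun _ => .refl _
  | null_zero => exact .null_zero (.refl _)
  | null_succ x => exact .null_succ (.refl _)
  | eq_left h => exact .eq (.rel _ _ h) (.refl _)
  | eq_right h => exact .eq (.refl _) (.rel _ _ h)
  | null h => exact .null (.rel _ _ h)
  | nat h => exact .nat (.rel _ _ h)
  | mem_left h => exact .mem (.rel _ _ h) (.refl _)
  | mem_right h => exact .mem (.refl _) h.conv
  | imp_left _ ih => exact .imp ih (.refl _)
  | imp_right _ ih => exact .imp (.refl _) ih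
  | and_left _ ih => exact .and ih (.refl _)
  | and_right _ ih => exact .and (.refl _) ih
  | or_left _ ih => exact .or ih (.refl _)
  | or_right _ ih => exact .or (.refl _) ih
  | all _ ih => exact .all ih
  | ex _ ih => exact .ex ih

theorem Par.congr {A B : Formula} (h : Par A B) : Congr A B := by
  induction h with
  | eq h h' => exact congr_eq h h'
  | eq_rule h h' => exact (congr_eq h h').trans (.rel _ _ (.eq_rule _ _))
  | null h => exact congr_null h
  | null_zero h => exact (congr_null h).trans (.rel _ _ .null_zero)
  | null_succ h => exact (congr_null h).trans (.rel _ _ (.null_succ _))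
  | nat h => exact congr_nat h
  | nat_rule h => exact (congr_nat h).trans (.rel _ _ (.nat_rule _))
  | mem h h' => exact congr_mem h h'
  | mem_cls P h h' => exact (congr_mem h (.cls P h')).trans (.rel _ _ (.mem_cls _ _ _))
  | top => exact .refl _
  | bot => exact .refl _
  | imp _ _ ih ih' => exact ih.imp ih'
  | and _ _ ih ih' => exact ih.and ih'
  | or _ _ ih ih' => exact ih.or ih'
  | all _ ih => exact ih.all
  | ex _ ih => exact ih.ex

theorem par_inst {n : ℕ} (P : NFormula n) {σ τ : Fin n → ITerm ℕ} (h : ∀ i, (σ i).Conv (τ i)) :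
    Par (P.inst σ) (P.inst τ) := by
  induction P with
  | eq t u => exact .eq (t.bind_conv h) (u.bind_conv h)
  | null t => exact .null (t.bind_conv h)
  | nat t => exact .nat (t.bind_conv h)
  | top => exact .top
  | bot => exact .bot
  | imp A B ihA ihB => exact .imp (ihA h) (ihB h)
  | and A B ihA ihB => exact .and (ihA h) (ihB h)
  | or A B ihA ihB => exact .or (ihA h) (ihB h)
  | all A ih =>
    exact .all (ih fun i => Fin.cases (ITerm.Conv.refl _) (fun i => (h i).bind _) i)
  | ex A ih =>
    exact .ex (ih fun i => Fin.cases (ITerm.Conv.refl _) (fun i => (h i).bind _) i)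

theorem conv_cons {n : ℕ} {t u : ITerm ℕ} {ts us : Fin n → ITerm ℕ} (h : t.Conv u)
    (h' : ∀ i, (ts i).Conv (us i)) (i : Fin (n + 1)) :
    ((Fin.cons t ts : Fin (n + 1) → ITerm ℕ) i).Conv ((Fin.cons u us : Fin (n + 1) → ITerm ℕ) i) :=
  Fin.cases h h' i

theorem par_eqBody {t t' u u' : ITerm ℕ} (h : t.Conv t') (h' : u.Conv u') :
    Par (eqBody t u) (eqBody t' u') :=
  .all (.imp (.mem h (.refl _)) (.mem h' (.refl _)))

theorem par_natBody {t t' : ITerm ℕ} (h : t.Conv t') : Par (natBody t) (natBody t') :=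
  .all (.imp (.refl _) (.imp (.refl _) (.mem h (.refl _))))

/-- All redexes are atomic propositions. Two steps from the same atom differ only in convertible
terms and in whether they unfold it, so unfolding on both sides closes the diagram. The clash
between `null_zero` and `null_succ` would make `0` convertible to a successor. Class terms keep
their defining proposition under conversion, so two comprehension steps agree up to `par_inst`. -/
theorem Par.diamond {A B C : Formula} (h : Par A B) (h' : Par A C) :
    ∃ D, Par B D ∧ Par C D := by
  induction h generalizing C with
  | @eq _ t _ u h₁ h₂ =>
    cases h' with
    | eq k₁ k₂ => exact ⟨.eq t u, .refl _, .eq (k₁.symm.trans h₁) (k₂.symm.trans h₂)⟩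
    | eq_rule k₁ k₂ =>
      exact ⟨eqBody t u, .eq_rule (.refl _) (.refl _),
        par_eqBody (k₁.symm.trans h₁) (k₂.symm.trans h₂)⟩
  | @eq_rule _ t _ u h₁ h₂ =>
    cases h' with
    | eq k₁ k₂ => exact ⟨eqBody t u, .refl _, .eq_rule (k₁.symm.trans h₁) (k₂.symm.trans h₂)⟩
    | eq_rule k₁ k₂ =>
      exact ⟨eqBody t u, .refl _, par_eqBody (k₁.symm.trans h₁) (k₂.symm.trans h₂)⟩
  | null h =>
    cases h' with
    | null k => exact ⟨_, .refl _, .null (k.symm.trans h)⟩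
    | null_zero k => exact ⟨_, .null_zero (h.symm.trans k), .refl _⟩
    | null_succ k => exact ⟨_, .null_succ (h.symm.trans k), .refl _⟩
  | null_zero h =>
    cases h' with
    | null k => exact ⟨_, .refl _, .null_zero (k.symm.trans h)⟩
    | null_zero k => exact ⟨_, .refl _, .refl _⟩
    | null_succ k => exact absurd (h.symm.trans k) (ITerm.not_zero_conv_succ _)
  | null_succ h =>
    cases h' with
    | null k => exact ⟨_, .refl _, .null_succ (k.symm.trans h)⟩
    | null_zero k => exact absurd (k.symm.trans h) (ITerm.not_zero_conv_succ _)
    | null_succ k => exact ⟨_, .refl _, .refl _⟩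
  | nat h =>
    cases h' with
    | nat k => exact ⟨_, .refl _, .nat (k.symm.trans h)⟩
    | nat_rule k => exact ⟨_, .nat_rule (h.symm.trans k), .refl _⟩
  | nat_rule h =>
    cases h' with
    | nat k => exact ⟨_, .refl _, .nat_rule (k.symm.trans h)⟩
    | nat_rule k => exact ⟨_, .refl _, par_natBody (k.symm.trans h)⟩
  | mem h₁ h₂ =>
    cases h' with
    | mem k₁ k₂ => exact ⟨_, .refl _, .mem (k₁.symm.trans h₁) (k₂.symm.trans h₂)⟩
    | mem_cls P k₁ k₂ =>
      cases h₂ with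
      | cls _ h₂ =>
        exact ⟨_, .mem_cls P (h₁.symm.trans k₁) fun i => (h₂ i).symm.trans (k₂ i), .refl _⟩
  | mem_cls P h₁ h₂ =>
    cases h' with
    | mem k₁ k₂ =>
      cases k₂ with
      | cls _ k₂ =>
        exact ⟨_, .refl _, .mem_cls P (k₁.symm.trans h₁) fun i => (k₂ i).symm.trans (h₂ i)⟩
    | mem_cls _ k₁ k₂ =>
      exact ⟨_, .refl _, par_inst P
        (conv_cons (k₁.symm.trans h₁) fun i => (k₂ i).symm.trans (h₂ i))⟩
  | top => exact ⟨C, h', .refl _⟩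
  | bot => exact ⟨C, h', .refl _⟩
  | imp _ _ ih₁ ih₂ =>
    cases h' with
    | imp k₁ k₂ =>
      obtain ⟨D₁, a₁, b₁⟩ := ih₁ k₁
      obtain ⟨D₂, a₂, b₂⟩ := ih₂ k₂
      exact ⟨_, .imp a₁ a₂, .imp b₁ b₂⟩
  | and _ _ ih₁ ih₂ =>
    cases h' with
    | and k₁ k₂ =>
      obtain ⟨D₁, a₁, b₁⟩ := ih₁ k₁
      obtain ⟨D₂, a₂, b₂⟩ := ih₂ k₂
      exact ⟨_, .and a₁ a₂, .and b₁ b₂⟩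
  | or _ _ ih₁ ih₂ =>
    cases h' with
    | or k₁ k₂ =>
      obtain ⟨D₁, a₁, b₁⟩ := ih₁ k₁
      obtain ⟨D₂, a₂, b₂⟩ := ih₂ k₂
      exact ⟨_, .or a₁ a₂, .or b₁ b₂⟩
  | all _ ih =>
    cases h' with
    | all k =>
      obtain ⟨D, a, b⟩ := ih k
      exact ⟨_, .all a, .all b⟩
  | ex _ ih =>
    cases h' with
    | ex k =>
      obtain ⟨D, a, b⟩ := ih k
      exact ⟨_, .ex a, .ex b⟩

/-- Congruent propositions have a common reduct. -/
theorem Congr.join {A B : Formula} (h : Congr A B) :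
    Relation.Join (Relation.ReflTransGen Par) A B := by
  have eqv : Equivalence (Relation.Join (Relation.ReflTransGen Par)) :=
    Relation.equivalence_join_reflTransGen fun a b c h h' =>
      let ⟨d, hb, hc⟩ := h.diamond h'
      ⟨d, .single hb, .single hc⟩
  induction h with
  | rel a b h => exact ⟨b, .single h.par, .refl⟩
  | refl a => exact eqv.refl a
  | symm a b _ ih => exact eqv.symm ih
  | trans a b c _ _ ih₁ ih₂ => exact eqv.trans ih₁ ih₂

/-- No rewrite rule acts at the head of a compound proposition, so its reducts keep the connective.
The same holds for the other connectives and the quantifiers. -/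
theorem pars_imp {A B X : Formula} (h : Relation.ReflTransGen Par (.imp A B) X) :
    ∃ A' B', X = .imp A' B' ∧ A.Congr A' ∧ B.Congr B' := by
  induction h with
  | refl => exact ⟨A, B, rfl, .refl _, .refl _⟩
  | tail _ h ih =>
    obtain ⟨A', B', rfl, hA, hB⟩ := ih
    cases h with | imp a b => exact ⟨_, _, rfl, hA.trans a.congr, hB.trans b.congr⟩

theorem pars_and {A B X : Formula} (h : Relation.ReflTransGen Par (.and A B) X) :
    ∃ A' B', X = .and A' B' ∧ A.Congr A' ∧ B.Congr B' := by
  induction h with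
  | refl => exact ⟨A, B, rfl, .refl _, .refl _⟩
  | tail _ h ih =>
    obtain ⟨A', B', rfl, hA, hB⟩ := ih
    cases h with | and a b => exact ⟨_, _, rfl, hA.trans a.congr, hB.trans b.congr⟩

theorem pars_or {A B X : Formula} (h : Relation.ReflTransGen Par (.or A B) X) :
    ∃ A' B', X = .or A' B' ∧ A.Congr A' ∧ B.Congr B' := by
  induction h with
  | refl => exact ⟨A, B, rfl, .refl _, .refl _⟩
  | tail _ h ih =>
    obtain ⟨A', B', rfl, hA, hB⟩ := ih
    cases h with | or a b => exact ⟨_, _, rfl, hA.trans a.congr, hB.trans b.congr⟩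

theorem pars_all {s : Srt} {A X : Formula} (h : Relation.ReflTransGen Par (.all s A) X) :
    ∃ A', X = .all s A' ∧ A.Congr A' := by
  induction h with
  | refl => exact ⟨A, rfl, .refl _⟩
  | tail _ h ih =>
    obtain ⟨A', rfl, hA⟩ := ih
    cases h with | all a => exact ⟨_, rfl, hA.trans a.congr⟩

theorem pars_ex {s : Srt} {A X : Formula} (h : Relation.ReflTransGen Par (.ex s A) X) :
    ∃ A', X = .ex s A' ∧ A.Congr A' := by
  induction h with
  | refl => exact ⟨A, rfl, .refl _⟩
  | tail _ h ih =>
    obtain ⟨A', rfl, hA⟩ := ih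
    cases h with | ex a => exact ⟨_, rfl, hA.trans a.congr⟩

/-- The common reduct is itself an implication, and its components link those of the two sides. -/
theorem Congr.imp_inj {A A' B B' : Formula} (h : Congr (.imp A B) (.imp A' B')) :
    Congr A A' ∧ Congr B B' := by
  obtain ⟨X, h₁, h₂⟩ := h.join
  obtain ⟨C, D, rfl, a, b⟩ := pars_imp h₁
  obtain ⟨_, _, e, a', b'⟩ := pars_imp h₂
  cases e
  exact ⟨a.trans a'.symm, b.trans b'.symm⟩

theorem Congr.and_inj {A A' B B' : Formula} (h : Congr (.and A B) (.and A' B')) :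
    Congr A A' ∧ Congr B B' := by
  obtain ⟨X, h₁, h₂⟩ := h.join
  obtain ⟨C, D, rfl, a, b⟩ := pars_and h₁
  obtain ⟨_, _, e, a', b'⟩ := pars_and h₂
  cases e
  exact ⟨a.trans a'.symm, b.trans b'.symm⟩

theorem Congr.or_inj {A A' B B' : Formula} (h : Congr (.or A B) (.or A' B')) :
    Congr A A' ∧ Congr B B' := by
  obtain ⟨X, h₁, h₂⟩ := h.join
  obtain ⟨C, D, rfl, a, b⟩ := pars_or h₁
  obtain ⟨_, _, e, a', b'⟩ := pars_or h₂
  cases e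
  exact ⟨a.trans a'.symm, b.trans b'.symm⟩

theorem Congr.all_inj {s : Srt} {A A' : Formula} (h : Congr (.all s A) (.all s A')) :
    Congr A A' := by
  obtain ⟨X, h₁, h₂⟩ := h.join
  obtain ⟨C, rfl, a⟩ := pars_all h₁
  obtain ⟨_, e, a'⟩ := pars_all h₂
  cases e
  exact a.trans a'.symm

theorem Congr.ex_inj {s : Srt} {A A' : Formula} (h : Congr (.ex s A) (.ex s A')) :
    Congr A A' := by
  obtain ⟨X, h₁, h₂⟩ := h.join
  obtain ⟨C, rfl, a⟩ := pars_ex h₁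
  obtain ⟨_, e, a'⟩ := pars_ex h₂
  cases e
  exact a.trans a'.symm

end Formula

/-! ### Subject reduction -/

namespace Proves

open Formula

/-- Conversion leaves no trace in the proof-term: it is absorbed by a congruence side condition, or
passed to the premises that share the conclusion (`orE`, `exE`), while `botE` has an arbitrary
conclusion. -/
theorem conv {Γ : List Formula} {π : PTerm} {A B : Formula} (h : Proves Γ π A)
    (e : A.Congr B) : Proves Γ π B := by
  induction h generalizing B with
  | ax h k => exact .ax h (k.trans e)
  | impI h k _ => exact .impI h (e.symm.trans k)
  | impE h h' k _ _ => exact .impE h h' (k.trans (Congr.imp (.refl _) e))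
  | andI h h' k _ _ => exact .andI h h' (e.symm.trans k)
  | andE₁ h k _ => exact .andE₁ h (k.trans (Congr.and e (.refl _)))
  | andE₂ h k _ => exact .andE₂ h (k.trans (Congr.and (.refl _) e))
  | orI₁ h k _ => exact .orI₁ h (e.symm.trans k)
  | orI₂ h k _ => exact .orI₂ h (e.symm.trans k)
  | orE h _ _ k _ ih₂ ih₃ => exact .orE h (ih₂ e) (ih₃ e) k
  | topI k => exact .topI (e.symm.trans k)
  | botE h k _ => exact .botE h k
  | allI h k _ => exact .allI h (e.symm.trans k)
  | allE t h k k' _ => exact .allE t h k (e.symm.trans k')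
  | exI t h k k' _ => exact .exI t h (e.symm.trans k) k'
  | exE h _ k _ ih => exact .exE h (ih (e.subst _)) k

theorem map_shift_map_subst (Γ : List Formula) (s : Srt) (σ : TSub) :
    (Γ.map (Formula.shift s)).map (fun A => A.subst (σ.up s)) =
      (Γ.map (fun A => A.subst σ)).map (Formula.shift s) := by
  simp [Function.comp_def, shift_subst_up]

theorem tsubst {Γ : List Formula} {π : PTerm} {A : Formula} (h : Proves Γ π A) (σ : TSub) :
    Proves (Γ.map fun A => A.subst σ) (π.tsubst σ) (A.subst σ) := by
  induction h generalizing σ with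
  | ax h k => exact .ax (by simp [h]) (k.subst σ)
  | impI _ k ih => exact .impI (ih σ) (k.subst σ)
  | impE _ _ k ih ih' => exact .impE (ih σ) (ih' σ) (k.subst σ)
  | andI _ _ k ih ih' => exact .andI (ih σ) (ih' σ) (k.subst σ)
  | andE₁ _ k ih => exact .andE₁ (ih σ) (k.subst σ)
  | andE₂ _ k ih => exact .andE₂ (ih σ) (k.subst σ)
  | orI₁ _ k ih => exact .orI₁ (ih σ) (k.subst σ)
  | orI₂ _ k ih => exact .orI₂ (ih σ) (k.subst σ)
  | orE _ _ _ k ih₁ ih₂ ih₃ => exact .orE (ih₁ σ) (ih₂ σ) (ih₃ σ) (k.subst σ)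
  | topI k => exact .topI (k.subst σ)
  | botE _ k ih => exact .botE (ih σ) (k.subst σ)
  | @allI Γ s π A B _ k ih =>
    refine .allI ?_ (k.subst σ)
    rw [← map_shift_map_subst]
    exact ih _
  | allE t _ k k' ih =>
    refine .allE _ (ih σ) (k.subst σ) ?_
    rw [← subst_single_subst]
    exact k'.subst σ
  | exI t _ k k' ih =>
    refine .exI _ (ih σ) (k.subst σ) ?_
    rw [← subst_single_subst]
    exact k'.subst σ
  | @exE Γ s π π' A B C _ _ k ih ih' =>
    refine .exE (ih σ) ?_ (k.subst σ)
    have := ih' (σ.up s)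
    rwa [List.map_cons, map_shift_map_subst, shift_subst_up] at this

theorem rename {Γ Δ : List Formula} {π : PTerm} {A : Formula} (h : Proves Γ π A) {r : ℕ → ℕ}
    (hr : ∀ a B, Γ[a]? = some B → Δ[r a]? = some B) : Proves Δ (π.rename r) A := by
  have up : ∀ {Γ Δ : List Formula} {r : ℕ → ℕ} (C : Formula),
      (∀ a B, Γ[a]? = some B → Δ[r a]? = some B) →
      ∀ a B, (C :: Γ)[a]? = some B → (C :: Δ)[PTerm.upRen r a]? = some B := by
    intro Γ Δ r C hr a B h
    cases a with
    | zero => exact h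
    | succ a => exact hr a B h
  have shift : ∀ {Γ Δ : List Formula} {r : ℕ → ℕ} (s : Srt),
      (∀ a B, Γ[a]? = some B → Δ[r a]? = some B) →
      ∀ a B, (Γ.map (Formula.shift s))[a]? = some B →
        (Δ.map (Formula.shift s))[r a]? = some B := by
    intro Γ Δ r s hr a B h
    simp only [List.getElem?_map, Option.map_eq_some_iff] at h ⊢
    obtain ⟨C, h, e⟩ := h
    exact ⟨C, hr a C h, e⟩
  induction h generalizing Δ r with
  | ax h k => exact .ax (hr _ _ h) k
  | impI _ k ih => exact .impI (ih (up _ hr)) k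
  | impE _ _ k ih ih' => exact .impE (ih hr) (ih' hr) k
  | andI _ _ k ih ih' => exact .andI (ih hr) (ih' hr) k
  | andE₁ _ k ih => exact .andE₁ (ih hr) k
  | andE₂ _ k ih => exact .andE₂ (ih hr) k
  | orI₁ _ k ih => exact .orI₁ (ih hr) k
  | orI₂ _ k ih => exact .orI₂ (ih hr) k
  | orE _ _ _ k ih₁ ih₂ ih₃ => exact .orE (ih₁ hr) (ih₂ (up _ hr)) (ih₃ (up _ hr)) k
  | topI k => exact .topI k
  | botE _ k ih => exact .botE (ih hr) k
  | allI _ k ih => exact .allI (ih (shift _ hr)) k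
  | allE t _ k k' ih => exact .allE t (ih hr) k k'
  | exI t _ k k' ih => exact .exI t (ih hr) k k'
  | exE _ _ k ih ih' => exact .exE (ih hr) (ih' (up _ (shift _ hr))) k

theorem subst {Γ Δ : List Formula} {π : PTerm} {A : Formula} (h : Proves Γ π A)
    {ρ : ℕ → PTerm} (hρ : ∀ a B, Γ[a]? = some B → Proves Δ (ρ a) B) :
    Proves Δ (π.subst ρ) A := by
  have up : ∀ {Γ Δ : List Formula} {ρ : ℕ → PTerm} (C : Formula),
      (∀ a B, Γ[a]? = some B → Proves Δ (ρ a) B) →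
      ∀ a B, (C :: Γ)[a]? = some B → Proves (C :: Δ) (PTerm.up ρ a) B := by
    intro Γ Δ ρ C hρ a B h
    cases a with
    | zero => exact .ax h (.refl _)
    | succ a => exact (hρ a B h).rename fun _ _ h => h
  have shift : ∀ {Γ Δ : List Formula} {ρ : ℕ → PTerm} (s : Srt),
      (∀ a B, Γ[a]? = some B → Proves Δ (ρ a) B) →
      ∀ a B, (Γ.map (Formula.shift s))[a]? = some B →
        Proves (Δ.map (Formula.shift s)) (PTerm.tup s ρ a) B := by
    intro Γ Δ ρ s hρ a B h
    simp only [List.getElem?_map, Option.map_eq_some_iff] at h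
    obtain ⟨C, h, rfl⟩ := h
    exact (hρ a C h).tsubst _
  induction h generalizing Δ ρ with
  | ax h k => exact (hρ _ _ h).conv k
  | impI _ k ih => exact .impI (ih (up _ hρ)) k
  | impE _ _ k ih ih' => exact .impE (ih hρ) (ih' hρ) k
  | andI _ _ k ih ih' => exact .andI (ih hρ) (ih' hρ) k
  | andE₁ _ k ih => exact .andE₁ (ih hρ) k
  | andE₂ _ k ih => exact .andE₂ (ih hρ) k
  | orI₁ _ k ih => exact .orI₁ (ih hρ) k
  | orI₂ _ k ih => exact .orI₂ (ih hρ) k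
  | orE _ _ _ k ih₁ ih₂ ih₃ => exact .orE (ih₁ hρ) (ih₂ (up _ hρ)) (ih₃ (up _ hρ)) k
  | topI k => exact .topI k
  | botE _ k ih => exact .botE (ih hρ) k
  | allI _ k ih => exact .allI (ih (shift _ hρ)) k
  | allE t _ k k' ih => exact .allE t (ih hρ) k k'
  | exI t _ k k' ih => exact .exI t (ih hρ) k k'
  | exE _ _ k ih ih' => exact .exE (ih hρ) (ih' (up _ (shift _ hρ))) k

theorem subst_single {Γ : List Formula} {π σ : PTerm} {A B : Formula}
    (h : Proves (A :: Γ) π B) (h' : Proves Γ σ A) : Proves Γ (π.subst (PTerm.single σ)) B := by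
  refine h.subst fun a C hC => ?_
  cases a with
  | zero =>
    simp only [List.getElem?_cons_zero, Option.some.injEq] at hC
    exact hC ▸ h'
  | succ a => exact .ax hC (.refl _)

theorem tsubst_single {Γ : List Formula} {s : Srt} {π : PTerm} {A : Formula}
    (h : Proves (Γ.map (Formula.shift s)) π A) (t : Tm s) :
    Proves Γ (π.tsubst (TSub.single t)) (A.subst (TSub.single t)) := by
  have := h.tsubst (TSub.single t)
  simpa [Function.comp_def, shift_subst_single] using this

/-- Subject reduction. -/
theorem step {Γ : List Formula} {π π' : PTerm} {A : Formula} (h : Proves Γ π A)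
    (r : PTerm.Step π π') : Proves Γ π' A := by
  induction h generalizing π' with
  | ax h k => cases r
  | impI _ k ih => cases r with | lam r => exact .impI (ih r) k
  | impE h h' k ih ih' =>
    cases r with
    | beta π₁ π₂ =>
      cases h with
      | impI h k' =>
        -- The abstraction and the application may read the same proposition as two different
        -- implications, which confluence identifies componentwise.
        obtain ⟨a, b⟩ := (k'.symm.trans k).imp_inj
        exact (h.subst_single (h'.conv a.symm)).conv b
    | app_left r => exact .impE (ih r) h' k
    | app_right r => exact .impE h (ih' r) k
  | andI h h' k ih ih' =>
    cases r with
    | pair_left r => exact .andI (ih r) h' k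
    | pair_right r => exact .andI h (ih' r) k
  | andE₁ h k ih =>
    cases r with
    | fst_pair => cases h with | andI h _ k' => exact h.conv (k'.symm.trans k).and_inj.1
    | fst r => exact .andE₁ (ih r) k
  | andE₂ h k ih =>
    cases r with
    | snd_pair => cases h with | andI _ h k' => exact h.conv (k'.symm.trans k).and_inj.2
    | snd r => exact .andE₂ (ih r) k
  | orI₁ _ k ih => cases r with | inl r => exact .orI₁ (ih r) k
  | orI₂ _ k ih => cases r with | inr r => exact .orI₂ (ih r) k
  | orE h₁ h₂ h₃ k ih₁ ih₂ ih₃ =>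
    cases r with
    | cases_inl =>
      cases h₁ with | orI₁ h k' => exact h₂.subst_single (h.conv (k'.symm.trans k).or_inj.1)
    | cases_inr =>
      cases h₁ with | orI₂ h k' => exact h₃.subst_single (h.conv (k'.symm.trans k).or_inj.2)
    | cases_fst r => exact .orE (ih₁ r) h₂ h₃ k
    | cases_snd r => exact .orE h₁ (ih₂ r) h₃ k
    | cases_trd r => exact .orE h₁ h₂ (ih₃ r) k
  | topI k => cases r
  | botE _ k ih => cases r with | botElim r => exact .botE (ih r) k
  | allI _ k ih => cases r with | tlam r => exact .allI (ih r) k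
  | allE t h k k' ih =>
    cases r with
    | tbeta _ π =>
      cases h with
      | allI h k'' =>
        exact (h.tsubst_single t).conv (((k''.symm.trans k).all_inj.subst _).trans k'.symm)
    | tapp r => exact .allE t (ih r) k k'
  | exI t h k k' ih => cases r with | tpair r => exact .exI t (ih r) k k'
  | exE h h' k ih ih' =>
    cases r with
    | exElim_tpair _ t π₁ π₂ =>
      cases h with
      | exI _ h k₁ k₂ =>
        -- The context and the conclusion are shifted, so instantiating the eigenvariable by the
        -- witness gives them back unchanged.
        have h₂ := h'.tsubst (TSub.single t)
        simp only [List.map_cons, List.map_map, Function.comp_def, shift_subst_single,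
          List.map_id'] at h₂
        exact h₂.subst_single (h.conv (k₂.trans ((k₁.symm.trans k).ex_inj.subst _)))
    | exElim_left r => exact .exE (ih r) h' k
    | exElim_right r => exact .exE h (ih' r) k

theorem steps {Γ : List Formula} {π π' : PTerm} {A : Formula} (h : Proves Γ π A)
    (r : Relation.ReflTransGen PTerm.Step π π') : Proves Γ π' A := by
  induction r with
  | refl => exact h
  | tail _ r ih => exact ih.step r

end Proves

theorem PTerm.StronglyNormalizable.exists_cutFree {π : PTerm} (h : π.StronglyNormalizable) :
    ∃ π', Relation.ReflTransGen PTerm.Step π π' ∧ π'.CutFree := by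
  induction h with
  | intro π _ ih =>
    by_cases hc : π.CutFree
    · exact ⟨π, .refl, hc⟩
    · simp only [PTerm.CutFree, not_forall, not_not] at hc
      obtain ⟨π₁, h₁⟩ := hc
      obtain ⟨π', h, h'⟩ := ih π₁ h₁
      exact ⟨π', .head h₁ h, h'⟩

/-! ### Reducibility candidates -/

namespace PTerm

/-- Proof-terms that end with an introduction rule. -/
def IsIntro : PTerm → Prop
  | lam _ => True
  | pair _ _ => True
  | inl _ => True
  | inr _ => True
  | triv => True
  | tlam _ _ => True
  | tpair _ _ _ => True
  | _ => False

/-- Reducibility candidates. -/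
structure IsCand (R : Set PTerm) : Prop where
  sn : ∀ {π}, π ∈ R → StronglyNormalizable π
  step : ∀ {π π'}, π ∈ R → Step π π' → π' ∈ R
  neutral : ∀ {π}, ¬ IsIntro π → (∀ π', Step π π' → π' ∈ R) → π ∈ R

/-- A variable is neutral and has no reducts. This permits substituting variables for hypotheses, so
that open subproofs inherit strong normalizability from their instances. -/
theorem IsCand.var_mem {R : Set PTerm} (h : IsCand R) (a : ℕ) : var a ∈ R :=
  h.neutral (fun h => h) fun _ r => by cases r

/-- The strongly normalizable proof-terms whose reducts that end with an introduction rule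
satisfy `K`. -/
def cand (K : PTerm → Prop) : Set PTerm :=
  {π | StronglyNormalizable π ∧ ∀ v, Relation.ReflTransGen Step π v → IsIntro v → K v}

/-- No stability of `K` is needed: `cand` already quantifies over all reducts, and a neutral term
reaches an introduction only through a proper reduct. -/
theorem isCand_cand (K : PTerm → Prop) : IsCand (cand K) where
  sn h := h.1
  step h r := ⟨h.1.inv r, fun v hv => h.2 v (.head r hv)⟩
  neutral hn h := by
    refine ⟨.intro _ fun π' r => (h π' r).1, fun v hv hi => ?_⟩
    rcases Relation.ReflTransGen.cases_head hv with rfl | ⟨π', r, hv⟩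
    · exact absurd hi hn
    · exact (h π' r).2 v hv hi

theorem cand_mono {K L : PTerm → Prop} (h : ∀ v, K v → L v) : cand K ⊆ cand L :=
  fun _ hπ => ⟨hπ.1, fun v hv hi => h v (hπ.2 v hv hi)⟩

/-- An infinite reduction of `π` would map to one of `f π`. -/
theorem StronglyNormalizable.of_map {f : PTerm → PTerm} (hf : ∀ π π', Step π π' → Step (f π) (f π'))
    {π : PTerm} (h : StronglyNormalizable (f π)) : StronglyNormalizable π := by
  generalize e : f π = σ at h
  induction h generalizing π with
  | intro σ _ ih =>
    subst e
    exact .intro _ fun π' r => ih _ (hf _ _ r) rfl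

theorem StronglyNormalizable.of_subst {π : PTerm} {ρ : ℕ → PTerm}
    (h : StronglyNormalizable (π.subst ρ)) : StronglyNormalizable π :=
  .of_map (f := fun π => π.subst ρ) (fun _ _ r => r.subst ρ) h

theorem StronglyNormalizable.of_tsubst {π : PTerm} {σ : TSub}
    (h : StronglyNormalizable (π.tsubst σ)) : StronglyNormalizable π :=
  .of_map (f := fun π => π.tsubst σ) (fun _ _ r => r.tsubst σ) h

/-- The values of a constructor `f` that only reduces inside its argument belong to `cand K` when
the argument is strongly normalizable and satisfies a property that is stable under reduction and
entails `K`. -/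
theorem mem_cand_of_congr {K Q : PTerm → Prop} {f : PTerm → PTerm}
    (hf : ∀ π v, Step (f π) v → ∃ π', v = f π' ∧ Step π π')
    (hQ : ∀ π π', Q π → Step π π' → Q π') (hK : ∀ π, Q π → K (f π)) {π : PTerm}
    (h : StronglyNormalizable π) (hπ : Q π) : f π ∈ cand K := by
  induction h with
  | intro π _ ih =>
    have key : ∀ v, Step (f π) v → v ∈ cand K := by
      intro v r
      obtain ⟨π', rfl, r'⟩ := hf _ _ r
      exact ih π' r' (hQ _ _ hπ r')
    refine ⟨.intro _ fun v r => (key v r).1, fun v hv hi => ?_⟩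
    rcases Relation.ReflTransGen.cases_head hv with rfl | ⟨v', r, hv⟩
    · exact hK π hπ
    · exact (key v' r).2 v hv hi

end PTerm

/-! ### Semantic connectives and quantifiers on candidates -/

open PTerm

/-- Sequences of reducibility candidates: the interpretation of the classes. -/
def Cls : Type := {E : ℕ → Set PTerm // ∀ n, IsCand (E n)}

/-- The interpretation of the sorts. -/
def Dom : Srt → Type
  | .iota => ℕ
  | .kappa => Cls

theorem Dom.nonempty (s : Srt) : Nonempty (Dom s) := by
  cases s with
  | iota => exact ⟨(0 : ℕ)⟩
  | kappa => exact ⟨(⟨fun _ => cand fun _ => True, fun _ => isCand_cand _⟩ : Cls)⟩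

/-- The candidate of all strongly normalizable proof-terms. -/
def snC : Set PTerm := cand fun _ => True

/-- Only introductions of the matching shape are constrained, since these are the ones that form a
cut with the elimination rule. -/
def impC (X Y : Set PTerm) : Set PTerm :=
  cand fun v => ∀ b, v = lam b → ∀ σ ∈ X, b.subst (single σ) ∈ Y

def andC (X Y : Set PTerm) : Set PTerm :=
  cand fun v => ∀ a b, v = pair a b → a ∈ X ∧ b ∈ Y

def orC (X Y : Set PTerm) : Set PTerm :=
  cand fun v => (∀ a, v = inl a → a ∈ X) ∧ ∀ b, v = inr b → b ∈ Y

/-- The term `t` and the value `E` range independently, so no realizability relation between terms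
and denotations is required. In `exC` the semantic witness is likewise not tied to the term. -/
def allC (s : Srt) (F : Dom s → Set PTerm) : Set PTerm :=
  cand fun v => ∀ b, v = tlam s b → ∀ (t : Tm s) (E : Dom s), b.tsubst (TSub.single t) ∈ F E

def exC (s : Srt) (F : Dom s → Set PTerm) : Set PTerm :=
  cand fun v => ∀ (t : Tm s) b, v = tpair s t b → ∃ E : Dom s, b ∈ F E

theorem impC_mono {X X' Y Y' : Set PTerm} (h : X' ⊆ X) (h' : Y ⊆ Y') : impC X Y ⊆ impC X' Y' :=
  cand_mono fun _ k b e σ hσ => h' (k b e σ (h hσ))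

theorem allC_mono {s : Srt} {F G : Dom s → Set PTerm} (h : ∀ E, F E ⊆ G E) :
    allC s F ⊆ allC s G :=
  cand_mono fun _ k b e t E => h E (k b e t E)

section Rules

variable {X Y Z : Set PTerm}

theorem triv_mem : triv ∈ snC :=
  ⟨.intro _ fun _ r => (nomatch r), fun _ _ _ => trivial⟩

/-- The hypothesis on instances survives reduction of the body, and its instance at a variable makes
the body strongly normalizable. -/
theorem lam_mem (hX : IsCand X) (hY : IsCand Y) {b : PTerm}
    (h : ∀ σ ∈ X, b.subst (single σ) ∈ Y) : lam b ∈ impC X Y := by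
  refine mem_cand_of_congr (f := lam) (Q := fun b => ∀ σ ∈ X, b.subst (single σ) ∈ Y)
    (fun _ _ r => ?_) (fun _ _ h r σ hσ => hY.step (h σ hσ) (r.subst _)) ?_
    (hY.sn (h _ (hX.var_mem 0))).of_subst h
  · cases r with | lam r => exact ⟨_, rfl, r⟩
  · rintro b h _ ⟨⟩
    exact h

theorem tlam_mem {s : Srt} {F : Dom s → Set PTerm} (hF : ∀ E, IsCand (F E)) {b : PTerm}
    (h : ∀ (t : Tm s) E, b.tsubst (TSub.single t) ∈ F E) : tlam s b ∈ allC s F := by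
  obtain ⟨E₀⟩ := Dom.nonempty s
  refine mem_cand_of_congr (f := tlam s)
    (Q := fun b => ∀ (t : Tm s) E, b.tsubst (TSub.single t) ∈ F E)
    (fun _ _ r => ?_) (fun _ _ h r t E => (hF E).step (h t E) (r.tsubst _)) ?_
    ((hF E₀).sn (h (Tm.var s 0) E₀)).of_tsubst h
  · cases r with | tlam r => exact ⟨_, rfl, r⟩
  · rintro b h _ ⟨⟩
    exact h

theorem inl_mem (hX : IsCand X) {π : PTerm} (h : π ∈ X) : inl π ∈ orC X Y := by
  refine mem_cand_of_congr (f := inl) (Q := fun π => π ∈ X) (fun _ _ r => ?_)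
    (fun _ _ h r => hX.step h r) ?_ (hX.sn h) h
  · cases r with | inl r => exact ⟨_, rfl, r⟩
  · exact fun a h => ⟨by rintro _ ⟨⟩; exact h, by rintro _ ⟨⟩⟩

theorem inr_mem (hY : IsCand Y) {π : PTerm} (h : π ∈ Y) : inr π ∈ orC X Y := by
  refine mem_cand_of_congr (f := inr) (Q := fun π => π ∈ Y) (fun _ _ r => ?_)
    (fun _ _ h r => hY.step h r) ?_ (hY.sn h) h
  · cases r with | inr r => exact ⟨_, rfl, r⟩
  · exact fun a h => ⟨by rintro _ ⟨⟩, by rintro _ ⟨⟩; exact h⟩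

theorem tpair_mem {s : Srt} {F : Dom s → Set PTerm} {E : Dom s} (hF : IsCand (F E)) {t : Tm s}
    {π : PTerm} (h : π ∈ F E) : tpair s t π ∈ exC s F := by
  refine mem_cand_of_congr (f := tpair s t) (Q := fun π => π ∈ F E) (fun _ _ r => ?_)
    (fun _ _ h r => hF.step h r) ?_ (hF.sn h) h
  · cases r with | tpair r => exact ⟨_, rfl, r⟩
  · rintro π h _ _ ⟨⟩
    exact ⟨E, h⟩

theorem pair_mem (hX : IsCand X) (hY : IsCand Y) {a b : PTerm} (ha : a ∈ X) (hb : b ∈ Y) :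
    pair a b ∈ andC X Y := by
  have sna := hX.sn ha
  induction sna generalizing b with
  | intro a _ iha =>
    have snb := hY.sn hb
    induction snb with
    | intro b _ ihb =>
      have key : ∀ v, Step (pair a b) v → v ∈ andC X Y := by
        intro v r
        cases r with
        | pair_left r => exact iha _ r (hX.step ha r) hb
        | pair_right r => exact ihb _ r (hY.step hb r)
      refine ⟨.intro _ fun v r => (key v r).1, fun v hv hi => ?_⟩
      rcases Relation.ReflTransGen.cases_head hv with rfl | ⟨v', r, hv⟩
      · rintro _ _ ⟨⟩
        exact ⟨ha, hb⟩
      · exact (key v' r).2 v hv hi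

/-- An elimination is neutral, so only its one-step reducts matter. A step inside a component is
handled by induction on strong normalizability, a cut at the root by the definition of the
candidate. The other elimination rules follow this pattern. -/
theorem app_mem (hX : IsCand X) (hY : IsCand Y) {π σ : PTerm} (h : π ∈ impC X Y) (hσ : σ ∈ X) :
    app π σ ∈ Y := by
  have sn := h.1
  induction sn generalizing σ with
  | intro π _ ih =>
    have snσ := hX.sn hσ
    induction snσ with
    | intro σ _ ihσ =>
      refine hY.neutral (fun h => h) fun v r => ?_
      cases r with
      | beta b _ => exact h.2 _ .refl trivial b rfl σ hσ
      | app_left r => exact ih _ r ((isCand_cand _).step h r) hσ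
      | app_right r => exact ihσ _ r (hX.step hσ r)

theorem fst_mem (hX : IsCand X) {π : PTerm} (h : π ∈ andC X Y) : fst π ∈ X := by
  have sn := h.1
  induction sn with
  | intro π _ ih =>
    refine hX.neutral (fun h => h) fun v r => ?_
    cases r with
    | fst_pair a b => exact (h.2 _ .refl trivial _ b rfl).1
    | fst r => exact ih _ r ((isCand_cand _).step h r)

theorem snd_mem (hY : IsCand Y) {π : PTerm} (h : π ∈ andC X Y) : snd π ∈ Y := by
  have sn := h.1
  induction sn with
  | intro π _ ih =>
    refine hY.neutral (fun h => h) fun v r => ?_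
    cases r with
    | snd_pair a b => exact (h.2 _ .refl trivial a _ rfl).2
    | snd r => exact ih _ r ((isCand_cand _).step h r)

theorem botElim_mem (hX : IsCand X) {π : PTerm} (h : StronglyNormalizable π) :
    botElim π ∈ X := by
  induction h with
  | intro π _ ih =>
    refine hX.neutral (fun h => h) fun v r => ?_
    cases r with | botElim r => exact ih _ r

theorem cases_mem (hX : IsCand X) (hY : IsCand Y) (hZ : IsCand Z) {π π₁ π₂ : PTerm}
    (h : π ∈ orC X Y) (h₁ : ∀ σ ∈ X, π₁.subst (single σ) ∈ Z)
    (h₂ : ∀ σ ∈ Y, π₂.subst (single σ) ∈ Z) : PTerm.cases π π₁ π₂ ∈ Z := by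
  have sn := h.1
  induction sn generalizing π₁ π₂ with
  | intro π _ ih =>
    have sn₁ : StronglyNormalizable π₁ := (hZ.sn (h₁ _ (hX.var_mem 0))).of_subst
    induction sn₁ generalizing π₂ with
    | intro π₁ _ ih₁ =>
      have sn₂ : StronglyNormalizable π₂ := (hZ.sn (h₂ _ (hY.var_mem 0))).of_subst
      induction sn₂ with
      | intro π₂ _ ih₂ =>
        refine hZ.neutral (fun h => h) fun v r => ?_
        cases r with
        | cases_inl a _ _ => exact h₁ a ((h.2 _ .refl trivial).1 a rfl)
        | cases_inr a _ _ => exact h₂ a ((h.2 _ .refl trivial).2 a rfl)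
        | cases_fst r => exact ih _ r ((isCand_cand _).step h r) h₁ h₂
        | cases_snd r => exact ih₁ _ r (fun σ hσ => hZ.step (h₁ σ hσ) (r.subst _)) h₂
        | cases_trd r => exact ih₂ _ r (fun σ hσ => hZ.step (h₂ σ hσ) (r.subst _))

theorem tapp_mem {s : Srt} {F : Dom s → Set PTerm} {E : Dom s} (hF : IsCand (F E)) {π : PTerm}
    (h : π ∈ allC s F) (t : Tm s) : tapp s π t ∈ F E := by
  have sn := h.1
  induction sn with
  | intro π _ ih =>
    refine hF.neutral (fun h => h) fun v r => ?_
    cases r with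
    | tbeta _ b _ => exact h.2 _ .refl trivial b rfl t E
    | tapp r => exact ih _ r ((isCand_cand _).step h r)

theorem exElim_mem {s : Srt} {F : Dom s → Set PTerm} (hF : ∀ E, IsCand (F E)) (hZ : IsCand Z)
    {π π' : PTerm} (h : π ∈ exC s F)
    (h' : ∀ (t : Tm s) E, ∀ σ ∈ F E, (π'.tsubst (TSub.single t)).subst (single σ) ∈ Z) :
    exElim s π π' ∈ Z := by
  obtain ⟨E₀⟩ := Dom.nonempty s
  have sn := h.1
  induction sn generalizing π' with
  | intro π _ ih =>
    have sn' : StronglyNormalizable π' :=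
      (hZ.sn (h' (Tm.var s 0) E₀ _ ((hF E₀).var_mem 0))).of_subst.of_tsubst
    induction sn' with
    | intro π' _ ih' =>
      refine hZ.neutral (fun h => h) fun v r => ?_
      cases r with
      | exElim_tpair _ t a _ =>
        obtain ⟨E, hE⟩ := h.2 _ .refl trivial t a rfl
        exact h' t E a hE
      | exElim_left r => exact ih _ r ((isCand_cand _).step h r) h'
      | exElim_right r =>
        exact ih' _ r fun t E σ hσ => hZ.step (h' t E σ hσ) ((r.tsubst _).subst _)

end Rules

/-! ### The model -/

/-- The interpretation of the unfolding of `N(n)`, as a monotone function of that of `N`. -/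
def natOp : (ℕ → Set PTerm) →o (ℕ → Set PTerm) where
  toFun X n := allC .kappa fun E : Cls =>
    impC (E.1 0) (impC (allC .iota fun m : ℕ => impC (X m) (impC (E.1 m) (E.1 (m + 1)))) (E.1 n))
  -- `X` lies to the left of exactly two nested implications, and the two reversals of inclusion
  -- cancel.
  monotone' _ _ h _ := allC_mono fun _ => impC_mono subset_rfl <|
    impC_mono (allC_mono fun m => impC_mono (h m) subset_rfl) subset_rfl

/-- The interpretation of the predicate `N`: a least fixed point. -/
def natC : ℕ → Set PTerm := natOp.lfp

theorem natOp_natC : natOp natC = natC := natOp.map_lfp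

/-- The interpretation of equality. -/
def eqC (m n : ℕ) : Set PTerm := allC .kappa fun E : Cls => impC (E.1 m) (E.1 n)

/-- The fixed point is taken among arbitrary families of sets; it consists of candidates because
every value of `natOp` has the form `cand K`. -/
theorem isCand_natC (n : ℕ) : IsCand (natC n) := by
  rw [← natOp_natC]
  exact isCand_cand _

/-- The interpretation of the propositions that define classes. -/
def NFormula.den : {n : ℕ} → NFormula n → (Fin n → ℕ) → Set PTerm
  | _, .eq t u, e => eqC (t.val e) (u.val e)
  | _, .null _, _ => snC
  | _, .nat t, e => natC (t.val e)
  | _, .top, _ => snC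
  | _, .bot, _ => snC
  | _, .imp A B, e => impC (A.den e) (B.den e)
  | _, .and A B, e => andC (A.den e) (B.den e)
  | _, .or A B, e => orC (A.den e) (B.den e)
  | _, .all A, e => allC .iota fun k : ℕ => A.den (Fin.cons k e)
  | _, .ex A, e => exC .iota fun k : ℕ => A.den (Fin.cons k e)

theorem NFormula.isCand_den {n : ℕ} (P : NFormula n) (e : Fin n → ℕ) : IsCand (P.den e) := by
  cases P <;> first | exact isCand_cand _ | exact isCand_natC _

/-- Assignments of values to the term variables. -/
structure Val : Type where
  num : ℕ → ℕ
  cls : ℕ → Cls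

/-- The assignment that maps variable `0` of sort `s` to `E` and shifts the other ones. -/
def Val.cons : {s : Srt} → Dom s → Val → Val
  | .iota, k, φ => ⟨fun | 0 => k | v + 1 => φ.num v, φ.cls⟩
  | .kappa, E, φ => ⟨φ.num, fun | 0 => E | v + 1 => φ.cls v⟩

theorem Val.ext' {φ ψ : Val} (h₁ : ∀ v, φ.num v = ψ.num v) (h₂ : ∀ v, φ.cls v = ψ.cls v) :
    φ = ψ := by
  cases φ; cases ψ
  simp only [Val.mk.injEq]
  exact ⟨funext h₁, funext h₂⟩

/-- The interpretation of terms of sort `κ`. -/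
def KTerm.den : KTerm → Val → Cls
  | .var v, φ => φ.cls v
  | .cls P ts, φ =>
    ⟨fun k => P.den (Fin.cons k fun i => (ts i).val φ.num), fun _ => P.isCand_den _⟩

/-- The interpretation of terms. -/
def Tm.den : {s : Srt} → Tm s → Val → Dom s
  | _, .num t, φ => t.val φ.num
  | _, .cls p, φ => p.den φ

/-- The assignment obtained by evaluating a substitution. -/
def TSub.den (σ : TSub) (φ : Val) : Val :=
  ⟨fun v => (σ.num v).val φ.num, fun v => (σ.cls v).den φ⟩

/-- The interpretation of propositions. -/
def Formula.den : Formula → Val → Set PTerm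
  | .eq t u, φ => eqC (t.val φ.num) (u.val φ.num)
  | .null _, _ => snC
  | .nat t, φ => natC (t.val φ.num)
  | .mem t p, φ => (p.den φ).1 (t.val φ.num)
  | .top, _ => snC
  | .bot, _ => snC
  | .imp A B, φ => impC (A.den φ) (B.den φ)
  | .and A B, φ => andC (A.den φ) (B.den φ)
  | .or A B, φ => orC (A.den φ) (B.den φ)
  | .all s A, φ => allC s fun E => A.den (φ.cons E)
  | .ex s A, φ => exC s fun E => A.den (φ.cons E)

theorem Formula.isCand_den (A : Formula) (φ : Val) : IsCand (A.den φ) := by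
  cases A with
  | nat t => exact isCand_natC _
  | mem t p => exact (p.den φ).2 _
  | _ => exact isCand_cand _

theorem KTerm.den_bind (p : KTerm) (σ : TSub) (φ : Val) :
    (p.bind σ).den φ = p.den (σ.den φ) := by
  cases p with
  | var v => rfl
  | cls P ts => simp only [KTerm.bind, KTerm.den, ITerm.val_bind]; rfl

theorem TSub.den_comp (σ τ : TSub) (φ : Val) : (σ.comp τ).den φ = σ.den (τ.den φ) :=
  Val.ext' (fun _ => ITerm.val_bind _ _ _) (fun _ => KTerm.den_bind _ _ _)

theorem TSub.den_shift {s : Srt} (E : Dom s) (φ : Val) : (TSub.shift s).den (φ.cons E) = φ := by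
  cases s <;> rfl

theorem TSub.den_cons {s : Srt} (t : Tm s) (σ : TSub) (φ : Val) :
    (TSub.cons t σ).den φ = (σ.den φ).cons (t.den φ) := by
  cases t <;> refine Val.ext' (fun v => ?_) (fun v => ?_) <;> first | rfl | (cases v <;> rfl)

theorem TSub.den_up {s : Srt} (σ : TSub) (E : Dom s) (φ : Val) :
    (σ.up s).den (φ.cons E) = (σ.den φ).cons E := by
  rw [TSub.up_eq, TSub.den_cons, TSub.den_comp, TSub.den_shift]
  congr 1
  cases s <;> rfl

theorem TSub.den_single {s : Srt} (t : Tm s) (φ : Val) :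
    (TSub.single t).den φ = φ.cons (t.den φ) :=
  TSub.den_cons _ _ _

theorem Formula.den_subst (A : Formula) (σ : TSub) (φ : Val) :
    (A.subst σ).den φ = A.den (σ.den φ) := by
  induction A generalizing σ φ with
  | eq t u => simp only [Formula.subst, Formula.den, ITerm.val_bind]; rfl
  | null t => rfl
  | nat t => simp only [Formula.subst, Formula.den, ITerm.val_bind]; rfl
  | mem t p => simp only [Formula.subst, Formula.den, ITerm.val_bind, KTerm.den_bind]; rfl
  | top => rfl
  | bot => rfl
  | imp A B ihA ihB => simp only [Formula.subst, Formula.den, ihA, ihB]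
  | and A B ihA ihB => simp only [Formula.subst, Formula.den, ihA, ihB]
  | or A B ihA ihB => simp only [Formula.subst, Formula.den, ihA, ihB]
  | all s A ih => simp only [Formula.subst, Formula.den, ih, TSub.den_up]
  | ex s A ih => simp only [Formula.subst, Formula.den, ih, TSub.den_up]

theorem Formula.den_shift {s : Srt} (A : Formula) (E : Dom s) (φ : Val) :
    (A.shift s).den (φ.cons E) = A.den φ := by
  rw [Formula.shift, Formula.den_subst, TSub.den_shift]

/-- This validates the comprehension rule: the value stored in a class term agrees with that of the
unfolded proposition. -/
theorem NFormula.den_inst {n : ℕ} (P : NFormula n) (σ : Fin n → ITerm ℕ) (φ : Val) :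
    (P.inst σ).den φ = P.den fun i => (σ i).val φ.num := by
  have key : ∀ {n : ℕ} (σ : Fin n → ITerm ℕ) (φ : Val) (k : ℕ),
      (fun i : Fin (n + 1) => ((Fin.cons (.var 0)
        (fun i => (σ i).bind (fun v => .var (v + 1))) : Fin (n + 1) → ITerm ℕ) i).val
          (Val.cons (s := .iota) k φ).num) = Fin.cons k fun i => (σ i).val φ.num := by
    intro n σ φ k
    funext i
    refine Fin.cases rfl (fun i => ?_) i
    simp only [Fin.cons_succ, ITerm.val_bind]
    rfl
  induction P generalizing φ with
  | eq t u => simp only [NFormula.inst, Formula.den, NFormula.den, ITerm.val_bind]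
  | null t => rfl
  | nat t => simp only [NFormula.inst, Formula.den, NFormula.den, ITerm.val_bind]
  | top => rfl
  | bot => rfl
  | imp A B ihA ihB => simp only [NFormula.inst, Formula.den, NFormula.den, ihA, ihB]
  | and A B ihA ihB => simp only [NFormula.inst, Formula.den, NFormula.den, ihA, ihB]
  | or A B ihA ihB => simp only [NFormula.inst, Formula.den, NFormula.den, ihA, ihB]
  | all A ih =>
    simp only [NFormula.inst, Formula.den, NFormula.den, ih]
    exact congrArg _ (funext fun k => congrArg _ (key σ φ k))
  | ex A ih =>
    simp only [NFormula.inst, Formula.den, NFormula.den, ih]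
    exact congrArg _ (funext fun k => congrArg _ (key σ φ k))

theorem KTerm.Step.den_eq {p q : KTerm} (h : KTerm.Step p q) (φ : Val) : p.den φ = q.den φ := by
  cases h.conv with
  | var v => rfl
  | cls P hc =>
    have e := funext fun i => (hc i).val_eq φ.num
    exact Subtype.ext (funext fun k => by simp only [KTerm.den, e])

/-- The model was built for this: the rules for `=` and `Null` hold by definition, the rule for `N`
by the fixed-point equation, and rewriting of terms preserves values. -/
theorem Formula.Step.den_eq {A B : Formula} (h : Formula.Step A B) (φ : Val) :
    A.den φ = B.den φ := by
  induction h generalizing φ with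
  | eq_rule y z => rfl
  | nat_rule n => exact (congrFun natOp_natC _).symm
  | mem_cls x P ts =>
    rw [NFormula.den_inst]
    refine congrArg P.den (funext fun i => ?_)
    exact Fin.cases rfl (fun i => rfl) i
  | null_zero => rfl
  | null_succ x => rfl
  | eq_left h => simp only [Formula.den, h.val_eq]
  | eq_right h => simp only [Formula.den, h.val_eq]
  | null h => rfl
  | nat h => simp only [Formula.den, h.val_eq]
  | mem_left h => simp only [Formula.den, h.val_eq]
  | mem_right h => simp only [Formula.den, h.den_eq]
  | imp_left _ ih => simp only [Formula.den, ih]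
  | imp_right _ ih => simp only [Formula.den, ih]
  | and_left _ ih => simp only [Formula.den, ih]
  | and_right _ ih => simp only [Formula.den, ih]
  | or_left _ ih => simp only [Formula.den, ih]
  | or_right _ ih => simp only [Formula.den, ih]
  | all _ ih => simp only [Formula.den, ih]
  | ex _ ih => simp only [Formula.den, ih]

theorem Formula.Congr.den_eq {A B : Formula} (h : A.Congr B) (φ : Val) : A.den φ = B.den φ := by
  induction h with
  | rel a b h => exact h.den_eq φ
  | refl a => rfl
  | symm a b _ ih => exact ih.symm
  | trans a b c _ _ ih₁ ih₂ => exact ih₁.trans ih₂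

/-! ### Strong normalization -/

theorem consSub_mem {Γ : List Formula} {φ : Val} {ρ : ℕ → PTerm} {A : Formula} {σ : PTerm}
    (hρ : ∀ a B, Γ[a]? = some B → ρ a ∈ B.den φ) (hσ : σ ∈ A.den φ) (a : ℕ) (B : Formula)
    (h : (A :: Γ)[a]? = some B) : consSub σ ρ a ∈ B.den φ := by
  cases a with
  | zero =>
    simp only [List.getElem?_cons_zero, Option.some.injEq] at h
    exact h ▸ hσ
  | succ a => exact hρ a B h

theorem mem_den_shift {Γ : List Formula} {φ : Val} {ρ : ℕ → PTerm} {s : Srt} (E : Dom s)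
    (hρ : ∀ a B, Γ[a]? = some B → ρ a ∈ B.den φ) (a : ℕ) (B : Formula)
    (h : (Γ.map (Formula.shift s))[a]? = some B) : ρ a ∈ B.den (φ.cons E) := by
  simp only [List.getElem?_map, Option.map_eq_some_iff] at h
  obtain ⟨C, h, rfl⟩ := h
  rw [Formula.den_shift]
  exact hρ a C h

/-- Every substitution instance of a proof by reducible proof-terms is reducible. -/
theorem Proves.mem_den {Γ : List Formula} {π : PTerm} {A : Formula} (h : Proves Γ π A) (φ : Val)
    (θ : TSub) (ρ : ℕ → PTerm) (hρ : ∀ a B, Γ[a]? = some B → ρ a ∈ B.den φ) :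
    (π.tsubst θ).subst ρ ∈ A.den φ := by
  have tsingle : ∀ {s : Srt} (π : PTerm) (θ : TSub) (ρ : ℕ → PTerm) (t : Tm s),
      ((π.tsubst (θ.up s)).subst (tup s ρ)).tsubst (TSub.single t) =
        (π.tsubst (TSub.cons t θ)).subst ρ := by
    intro s π θ ρ t
    rw [subst_tup_single, tsubst_tsubst, TSub.up_comp_single]
  -- The syntactic substitution `θ` and the assignment `φ` vary independently; under a quantifier
  -- they are extended by an arbitrary term and an arbitrary value.
  induction h generalizing φ θ ρ with
  | ax h k => exact k.den_eq φ ▸ hρ _ _ h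
  | @impI Γ π A B C _ k ih =>
    rw [k.den_eq]
    refine lam_mem (A.isCand_den φ) (B.isCand_den φ) fun σ hσ => ?_
    rw [subst_up_single]
    exact ih φ θ _ (consSub_mem hρ hσ)
  | @impE Γ π π' A B C _ _ k ih ih' =>
    exact app_mem (A.isCand_den φ) (B.isCand_den φ) ((k.den_eq φ).subset (ih φ θ ρ hρ)) (ih' φ θ ρ hρ)
  | @andI Γ π π' A B C _ _ k ih ih' =>
    rw [k.den_eq]
    exact pair_mem (A.isCand_den φ) (B.isCand_den φ) (ih φ θ ρ hρ) (ih' φ θ ρ hρ)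
  | @andE₁ Γ π A B C _ k ih =>
    exact fst_mem (A.isCand_den φ) ((k.den_eq φ).subset (ih φ θ ρ hρ) : _ ∈ andC _ (B.den φ))
  | @andE₂ Γ π A B C _ k ih =>
    exact snd_mem (B.isCand_den φ) ((k.den_eq φ).subset (ih φ θ ρ hρ) : _ ∈ andC (A.den φ) _)
  | @orI₁ Γ π A B C _ k ih =>
    rw [k.den_eq]
    exact inl_mem (A.isCand_den φ) (ih φ θ ρ hρ)
  | @orI₂ Γ π A B C _ k ih =>
    rw [k.den_eq]
    exact inr_mem (B.isCand_den φ) (ih φ θ ρ hρ)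
  | @orE Γ π₁ π₂ π₃ A B C D _ _ _ k ih₁ ih₂ ih₃ =>
    refine cases_mem (A.isCand_den φ) (B.isCand_den φ) (C.isCand_den φ)
      ((k.den_eq φ).subset (ih₁ φ θ ρ hρ)) (fun σ hσ => ?_) (fun σ hσ => ?_)
    · rw [subst_up_single]
      exact ih₂ φ θ _ (consSub_mem hρ hσ)
    · rw [subst_up_single]
      exact ih₃ φ θ _ (consSub_mem hρ hσ)
  | topI k =>
    rw [k.den_eq]
    exact triv_mem
  | @botE Γ π A B _ k ih =>
    exact botElim_mem (A.isCand_den φ) ((B.isCand_den φ).sn (ih φ θ ρ hρ))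
  | @allI Γ s π A B _ k ih =>
    rw [k.den_eq]
    refine tlam_mem (fun E => A.isCand_den _) fun t E => ?_
    rw [tsingle]
    exact ih (φ.cons E) _ ρ (mem_den_shift E hρ)
  | @allE Γ s π A B C t _ k k' ih =>
    -- The semantic instance is the value of `t` under `φ`, whereas the proof-term carries `t.subst
    -- θ`.
    rw [k'.den_eq, Formula.den_subst, TSub.den_single]
    exact tapp_mem (F := fun E => A.den (φ.cons E)) (A.isCand_den _)
      ((k.den_eq φ).subset (ih φ θ ρ hρ)) _
  | @exI Γ s π A B C t _ k k' ih =>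
    rw [k.den_eq]
    have := ih φ θ ρ hρ
    rw [k'.den_eq, Formula.den_subst, TSub.den_single] at this
    exact tpair_mem (F := fun E => A.den (φ.cons E)) (A.isCand_den _) this
  | @exE Γ s π π' A B C _ _ k ih ih' =>
    refine exElim_mem (F := fun E => A.den (φ.cons E)) (fun E => A.isCand_den _)
      (B.isCand_den φ) ((k.den_eq φ).subset (ih φ θ ρ hρ)) fun t E σ hσ => ?_
    -- Exchanging the two liftings brings the term binder outermost, so that `tsingle` applies.
    have e : up (tup s ρ) = tup s (up ρ) := (tsubst_up ρ _).symm
    rw [e, tsingle, subst_up_single, ← B.den_shift E φ]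
    exact ih' (φ.cons E) _ _ (consSub_mem (mem_den_shift E hρ) hσ)

/-- The identity substitutions are admissible in `Proves.mem_den`, since variables belong to every
candidate. -/
theorem Proves.stronglyNormalizable {Γ : List Formula} {π : PTerm} {A : Formula}
    (h : Proves Γ π A) : π.StronglyNormalizable := by
  obtain ⟨E⟩ := Dom.nonempty .kappa
  have := h.mem_den ⟨fun _ => 0, fun _ => E⟩ TSub.id PTerm.var
    fun a B _ => (B.isCand_den _).var_mem a
  rw [tsubst_id, subst_var] at this
  exact (A.isCand_den _).sn this

end HAModulo

/-- In `HA→` every proof is strongly normalizable, and it reduces to a cut-free proof of the same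
sequent. -/
theorem mainTheorem2 (Γ : List HAModulo.Formula) (π : HAModulo.PTerm) (A : HAModulo.Formula)
    (h : HAModulo.Proves Γ π A) :
    HAModulo.PTerm.StronglyNormalizable π ∧
      ∃ π' : HAModulo.PTerm, Relation.ReflTransGen HAModulo.PTerm.Step π π' ∧
        HAModulo.PTerm.CutFree π' ∧ HAModulo.Proves Γ π' A := by
  obtain ⟨π', r, hc⟩ := h.stronglyNormalizable.exists_cutFree
  exact ⟨h.stronglyNormalizable, π', r, hc, h.steps r⟩
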